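/- Let $\Omega\subset\mathbb R^3$ be a bounded domain, $T>0$, and let $\mu_1,\mu_4,\mu_5,\mu_6,\lambda\in\mathbb R$ satisfy $\mu_4>0$, $\mu_5+\mu_6-\lambda^2\ge 0$, $\mu_1+\lambda^2\ge 0$. **Notation.** $(\nabla u)_{ij}=\partial_j u_i$, $A:B=\sum_{i,j}A_{ij}B_{ij}$; $(A)_{\rm sym}$, $(A)_{\rm skw}$ are the symmetric and skew parts of $A$, and $(A)_{{\rm sym},-}$ is the negative semidefinite part of $(A)_{\rm sym}$; matrices carry the spectral norm $|\cdot|_2$. $L^2_\sigma(\Omega)$ and $H^1_{0,\sigma}(\Omega)$ are the closures in $L^2$ and $H^1$ of the divergence-free fields in $C_c^\infty(\Omega;\mathbb R^3)$; $H^1(\Omega;\mathbb S^2)$ is the set of $d\in H^1(\Omega;\mathbb R^3)$ with $|d|=1$ a.e.; $C_w$ means weakly continuous. $\mathcal E(v,d)=\frac12\|v\|_{L^2(\Omega)}^2+\frac12\|\nabla d\|_{L^2(\Omega)}^2$. $d\times\Delta d$ is the weak divergence of $d\times\nabla d$ (cross product taken column by column), and, for $|d|=1$, $(I-d\otimes d)\Delta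 d:=-d\times(d\times\Delta d)$ and $[d\otimes\Delta d]_{\rm skw}:=[d\otimes(I-d\otimes d)\Delta d]_{\rm skw}$. Put $$T^D=(\mu_1+\lambda^2)\,(d\cdot(\nabla v)_{\rm sym}d)\,d\otimes d+\mu_4(\nabla v)_{\rm sym}+(\mu_5+\mu_6-\lambda^2)\,(d\otimes(\nabla v)_{\rm sym}d)_{\rm sym},$$ $$T^{\rm el}=\lambda[d\otimes(I-d\otimes d)\Delta d]_{\rm sym}+[d\otimes\Delta d]_{\rm skw},\qquad T^L=T^D+T^{\rm el}.$$ **Director equation.** A pair $(v,d)$ is said to satisfy (D) if $v\in C_w([0,T];L^2_\sigma(\Omega))\cap L^2(0,T;H^1_{0,\sigma}(\Omega))$, $d\in C_w([0,T];H^1(\Omega;\mathbb S^2))\cap H^1(0,T;L^{3/2}(\Omega;\mathbb R^3))$, $d\times\Delta d\in L^2(0,T;L^2(\Omega;\mathbb R^3))$, and, a.e. in $\Omega\times(0,T)$, $$\partial_t d+(v\cdot\nabla)d-(\nabla v)_{\rm skw}d+(I-d\otimes d)\big(\lambda(\nabla v)_{\rm sym}d-\Delta d\big)=0 .$$ **Energy-variational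 solutions.** Let $\mathcal K(\tilde v)=2\|(\nabla\tilde v)_{{\rm sym},-}\|_{C(\overline\Omega)}$. A triple $(v,d,E)$ is an energy-variational solution with data $v_0,d_0,d_\Gamma$ if (D) holds, $E:[0,T]\to\mathbb R$ has bounded variation, $E\ge\mathcal E(v,d)$ on $[0,T]$, $v(0)=v_0$, $d(0)=d_0$, $d(t)-d_\Gamma\in H^1_0(\Omega;\mathbb R^3)$ for a.e. $t$ (equality of the traces on $\partial\Omega$), and $$\Big[E-\int_\Omega v\cdot\tilde v\,dx\Big]\Big|_{s-}^t+\int_s^t\langle\partial_t\tilde v,v\rangle\,d\tau+\int_s^t\!\int_\Omega\Big(-(v\cdot\nabla)v\cdot\tilde v+\nabla d^T\nabla d:\nabla\tilde v+T^D:(\nabla v-\nabla\tilde v)+|d\times\Delta d|^2-T^{\rm el}:\nabla\tilde v\Big)dx\,d\tau+\int_s^t\mathcal K(\tilde v)\big[\mathcal E(v,d)-E\big]d\tau\le 0$$ for all $0\le s<t<T$ (with $E(0-):=E(0)$) and all $\tilde v\in C^1([0,T];(H^1_{0,\sigma}(\Omega))^*)\cap L^2(0,T;H^1_{0,\sigma}(\Omega))$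 such that $(\nabla\tilde v(t))_{{\rm sym},-}\in C(\overline\Omega)$ for a.e. $t$ and $\mathcal K(\tilde v)\in L^1(0,T)$. **Measure-valued solutions.** A triple $(v,d,m)$ is a measure-valued solution if (D) holds, $m\in L^\infty_{w^*}(0,T;\mathcal M(\overline\Omega;\mathbb R^{3\times3}_{{\rm sym},+}))$ (that is, each $m_t$ is a Radon measure on $\overline\Omega$ with values in the positive semidefinite symmetric matrices, and $t\mapsto m_t$ is weakly-$*$ measurable and essentially bounded in the norm dual to $C(\overline\Omega)$), $$\int_0^T\Big[\int_\Omega T^L:\nabla\tilde v-(v\otimes v+\nabla d^T\nabla d):\nabla\tilde v-v\cdot\partial_t\tilde v\,dx-2\int_{\overline\Omega}(\nabla\tilde v)_{\rm sym}:dm_t(x)\Big]dt=0$$ for all $\tilde v\in C_c^\infty(\Omega\times(0,T);\mathbb R^3)$ with $\nabla\cdot\tilde v=0$, and, for a.e. $t\in(0,T)$, $$\mathcal E(v(t),d(t))+\frac12\int_{\overline\Omega}I:dm_t(x)+\int_0^t\int_\Omega T^D:(\nabla v)_{\rm sym}+|d\times\Delta d|^2\,dx\,ds\le\mathcal E(v(0),d(0)).$$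 **Theorem.** Let $(v,d,E)$ be an energy-variational solution with data $v_0,d_0,d_\Gamma$ such that $E(0)=\mathcal E(v_0,d_0)$. Then there exists $m$ such that $(v,d,m)$ (with the same $v$ and $d$) is a measure-valued solution and $$\frac12\langle m,I\rangle=\frac12\int_{\overline\Omega}I:dm=\frac12\int_{\overline\Omega}d\,{\rm tr}(m)\le E-\mathcal E(v,d)\quad\text{a.e. in }(0,T).$$ -/

import Mathlib

open MeasureTheory Set Filter Topology
open scoped ENNReal Matrix ContDiff

noncomputable section

namespace EricksenLeslie

/-! ### Vectors and matrices in dimension three -/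

abbrev E3 := EuclideanSpace ℝ (Fin 3)

abbrev Mat3 := Matrix (Fin 3) (Fin 3) ℝ

/-- Frobenius product `A : B`. -/
def frob (A B : Mat3) : ℝ := ∑ i, ∑ j, A i j * B i j

def symPart (A : Mat3) : Mat3 := (1 / 2 : ℝ) • (A + Aᵀ)

def skwPart (A : Mat3) : Mat3 := (1 / 2 : ℝ) • (A - Aᵀ)

/-- `a ⊗ b`. -/
def outer (a b : E3) : Mat3 := Matrix.of fun i j => a i * b j

/-- Matrix times vector. -/
def mv (A : Mat3) (x : E3) : E3 := WithLp.toLp 2 (A *ᵥ x.ofLp)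

/-- Cross product of two vectors. -/
def cross (a b : E3) : E3 := WithLp.toLp 2 (crossProduct a.ofLp b.ofLp)

/-- Cross product of a vector with a matrix, taken column by column:
`(a × A)_{ij} = ∑_{l,m} ε_{ilm} a_l A_{mj}`. -/
def crossMat (a : E3) (A : Mat3) : Mat3 :=
  Matrix.of fun i j => crossProduct a.ofLp (fun m => A m j) i

theorem symPart_isHermitian (A : Mat3) : (symPart A).IsHermitian := by
  ext i j
  simp [symPart, add_comm, mul_add]

/-- The negative semidefinite part `(A)_{sym,-}` of the symmetric part of `A`: every eigenvalue
`r` of `(A)_{sym}` is replaced by `min r 0`. -/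
def symNegPart (A : Mat3) : Mat3 := (symPart_isHermitian A).cfc fun r => min r 0

/-- The spectral norm: the norm as an operator on Euclidean space. -/
def matSpectralNorm (A : Mat3) : ℝ := ‖Matrix.toEuclideanCLM (n := Fin 3) (𝕜 := ℝ) A‖

/-! ### Function spaces on `Ω` -/

/-- Lebesgue measure on `Ω`. -/
abbrev vol (Ω : Set E3) : Measure E3 := volume.restrict Ω

/-- The classical gradient `(∇ φ)_{ij} = ∂_j φ_i`. -/
def grad (φ : E3 → E3) (x : E3) : Mat3 :=
  Matrix.of fun i j => (fderiv ℝ φ x (EuclideanSpace.single j 1)) i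

/-- `φ ∈ C_c^∞(Ω; ℝ³)`. -/
def IsTest (Ω : Set E3) (φ : E3 → E3) : Prop :=
  ContDiff ℝ ∞ φ ∧ HasCompactSupport φ ∧ tsupport φ ⊆ Ω

/-- `φ ∈ C_{c,σ}^∞(Ω; ℝ³)`: test fields without divergence. -/
def IsSolenoidalTest (Ω : Set E3) (φ : E3 → E3) : Prop :=
  IsTest Ω φ ∧ ∀ x, (grad φ x).trace = 0

/-- `u ∈ H¹(Ω; ℝ³)` with weak gradient `G`, `G_{ij} = ∂_j u_i`. -/
def IsH1With (Ω : Set E3) (u : E3 → E3) (G : E3 → Mat3) : Prop :=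
  MemLp u 2 (vol Ω) ∧ (∀ i j, MemLp (fun x => G x i j) 2 (vol Ω)) ∧
    ∀ φ : E3 → ℝ, ContDiff ℝ ∞ φ → HasCompactSupport φ → tsupport φ ⊆ Ω → ∀ i j,
      ∫ x in Ω, u x i * fderiv ℝ φ x (EuclideanSpace.single j 1) = -∫ x in Ω, G x i j * φ x

open Classical in
/-- The weak gradient of `u ∈ H¹(Ω; ℝ³)`, unique up to null sets. -/
def weakGrad (Ω : Set E3) (u : E3 → E3) : E3 → Mat3 :=
  if h : ∃ G, IsH1With Ω u G then h.choose else 0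

/-- Pairs (function, gradient) in `L²(Ω)`; the norm is equivalent to the norm of `H¹`. -/
abbrev H1Pair (Ω : Set E3) := Lp E3 2 (vol Ω) × (Fin 3 → Fin 3 → Lp ℝ 2 (vol Ω))

/-- The pair `p` consists of the classes of `u` and of `G`. -/
def Represents (Ω : Set E3) (p : H1Pair Ω) (u : E3 → E3) (G : E3 → Mat3) : Prop :=
  p.1 =ᵐ[vol Ω] u ∧ ∀ i j, p.2 i j =ᵐ[vol Ω] fun x => G x i j

/-- `L²_σ(Ω)`: the closure of `C_{c,σ}^∞(Ω; ℝ³)` in `L²`. -/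
def L2sigma (Ω : Set E3) : Submodule ℝ (Lp E3 2 (vol Ω)) :=
  (Submodule.span ℝ {p : Lp E3 2 (vol Ω) | ∃ φ, IsSolenoidalTest Ω φ ∧ p =ᵐ[vol Ω] φ}).topologicalClosure

/-- `H¹_{0,σ}(Ω)`: the closure of `C_{c,σ}^∞(Ω; ℝ³)` in `H¹`. -/
def H10sigma (Ω : Set E3) : Submodule ℝ (H1Pair Ω) :=
  (Submodule.span ℝ
    {p | ∃ φ, IsSolenoidalTest Ω φ ∧ Represents Ω p φ (grad φ)}).topologicalClosure

/-- `H¹_0(Ω; ℝ³)`: the closure of `C_c^∞(Ω; ℝ³)` in `H¹`. -/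
def H10 (Ω : Set E3) : Submodule ℝ (H1Pair Ω) :=
  (Submodule.span ℝ {p | ∃ φ, IsTest Ω φ ∧ Represents Ω p φ (grad φ)}).topologicalClosure

def MemL2sigma (Ω : Set E3) (u : E3 → E3) : Prop := ∃ p ∈ L2sigma Ω, p =ᵐ[vol Ω] u

/-- `u ∈ H¹_{0,σ}(Ω)` with gradient `G`. -/
def MemH10sigma (Ω : Set E3) (u : E3 → E3) (G : E3 → Mat3) : Prop :=
  ∃ p ∈ H10sigma Ω, Represents Ω p u G

/-- `u ∈ H¹_0(Ω; ℝ³)`, that is, `u` has trace zero on `∂Ω`. -/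
def MemH10 (Ω : Set E3) (u : E3 → E3) : Prop := ∃ G, ∃ p ∈ H10 Ω, Represents Ω p u G

open Classical in
/-- The element of `H¹_{0,σ}(Ω)` given by the function `u` with gradient `G`. -/
def toH10sigma (Ω : Set E3) (u : E3 → E3) (G : E3 → Mat3) : H10sigma Ω :=
  if h : MemH10sigma Ω u G then ⟨h.choose, h.choose_spec.1⟩ else 0

/-! ### The model -/

/-- The coefficients of the Leslie stress, with the conditions that make it dissipative. -/
structure Coefficients where
  μ₁ : ℝ
  μ₄ : ℝ
  μ₅ : ℝ
  μ₆ : ℝ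
  lam : ℝ
  μ₄_pos : 0 < μ₄
  μ₅₆_nonneg : 0 ≤ μ₅ + μ₆ - lam ^ 2
  μ₁_nonneg : 0 ≤ μ₁ + lam ^ 2

/-- Dissipative Leslie stress `T^D`, for the director `d` and the velocity gradient `G`. -/
def stressD (c : Coefficients) (d : E3) (G : Mat3) : Mat3 :=
  ((c.μ₁ + c.lam ^ 2) * inner ℝ d (mv (symPart G) d)) • outer d d + c.μ₄ • symPart G
    + (c.μ₅ + c.μ₆ - c.lam ^ 2) • symPart (outer d (mv (symPart G) d))

/-- `(I - d ⊗ d) Δd = [d]ₓᵀ [d]ₓ Δd = - d × (d × Δd)`, in terms of `w = d × Δd`. -/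
def projLap (d w : E3) : E3 := -cross d w

/-- The elastic part `λ [d ⊗ [d]ₓᵀ [d]ₓ Δd]_{sym} + [d ⊗ Δd]_{skw}` of the Leslie stress, in terms
of `w = d × Δd`. The component of `Δd` along `d` contributes a multiple of the symmetric matrix
`d ⊗ d` to `d ⊗ Δd` and so drops out of the skew part. -/
def stressElastic (c : Coefficients) (d w : E3) : Mat3 :=
  c.lam • symPart (outer d (projLap d w)) + skwPart (outer d (projLap d w))

/-- The Leslie stress `T^L`. -/
def stressL (c : Coefficients) (d : E3) (G : Mat3) (w : E3) : Mat3 :=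
  stressD c d G + stressElastic c d w

/-- The total energy `ℰ(u, δ) = ½ ‖u‖² + ½ ‖∇δ‖²` (norms of `L²(Ω)`). -/
def energy (Ω : Set E3) (u δ : E3 → E3) : ℝ :=
  1 / 2 * (∫ x in Ω, ‖u x‖ ^ 2) + 1 / 2 * ∫ x in Ω, frob (weakGrad Ω δ x) (weakGrad Ω δ x)

/-- The measure on the space-time cylinder `(0,T) × Ω`. -/
abbrev cyl (Ω : Set E3) (T : ℝ) : Measure (ℝ × E3) := (volume.restrict (Ioo 0 T)).prod (vol Ω)

/-- `φ ∈ C_c^∞(Ω × (0,T); ℝ³)`. -/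
def IsSpaceTimeTest (Ω : Set E3) (T : ℝ) (φ : ℝ → E3 → E3) : Prop :=
  ContDiff ℝ ∞ (Function.uncurry φ) ∧ HasCompactSupport (Function.uncurry φ) ∧
    tsupport (Function.uncurry φ) ⊆ Ioo 0 T ×ˢ Ω

/-- The regularity of a pair (velocity `v`, director `d`) and the director equation, together with
the (essentially unique) derivatives of `v` and `d` that occur in the equations:
`gradV = ∇v`, `gradD = ∇d`, `dtD = ∂ₜd` and `w = d × Δd`. -/
structure FlowFields (Ω : Set E3) (T : ℝ) (c : Coefficients) (v d : ℝ → E3 → E3) where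
  gradV : ℝ → E3 → Mat3
  gradD : ℝ → E3 → Mat3
  dtD : ℝ → E3 → E3
  w : ℝ → E3 → E3
  -- `v ∈ C_w([0,T]; L²_σ)`
  v_meas : AEStronglyMeasurable (Function.uncurry v) (cyl Ω T)
  v_mem : ∀ t ∈ Icc 0 T, MemL2sigma Ω (v t)
  v_cont : ∀ ψ : E3 → E3, MemLp ψ 2 (vol Ω) →
    ContinuousOn (fun t => ∫ x in Ω, inner ℝ (v t x) (ψ x)) (Icc 0 T)
  -- `v ∈ L²(0,T; H¹_{0,σ})`
  gradV_mem : ∀ i j, MemLp (fun z : ℝ × E3 => gradV z.1 z.2 i j) 2 (cyl Ω T)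
  v_H1 : ∀ᵐ t ∂volume.restrict (Ioo 0 T), MemH10sigma Ω (v t) (gradV t)
  -- `d ∈ C_w([0,T]; H¹(Ω; 𝕊²))`
  d_meas : AEStronglyMeasurable (Function.uncurry d) (cyl Ω T)
  gradD_meas : AEStronglyMeasurable (Function.uncurry gradD) (cyl Ω T)
  d_H1 : ∀ t ∈ Icc 0 T, IsH1With Ω (d t) (gradD t)
  d_unit : ∀ t ∈ Icc 0 T, ∀ᵐ x ∂vol Ω, ‖d t x‖ = 1
  d_cont : ∀ ψ : E3 → E3, MemLp ψ 2 (vol Ω) →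
    ContinuousOn (fun t => ∫ x in Ω, inner ℝ (d t x) (ψ x)) (Icc 0 T)
  gradD_cont : ∀ i j, ∀ ψ : E3 → ℝ, MemLp ψ 2 (vol Ω) →
    ContinuousOn (fun t => ∫ x in Ω, gradD t x i j * ψ x) (Icc 0 T)
  -- `d ∈ H¹(0,T; L^{3/2})`
  dtD_meas : AEStronglyMeasurable (Function.uncurry dtD) (cyl Ω T)
  dtD_mem : ∫⁻ t in Ioo 0 T, eLpNorm (dtD t) (3 / 2) (vol Ω) ^ 2 < ⊤
  dtD_spec : ∀ φ, IsSpaceTimeTest Ω T φ →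
    ∫ t in Ioo 0 T, ∫ x in Ω, inner ℝ (d t x) (deriv (fun s => φ s x) t)
      = -∫ t in Ioo 0 T, ∫ x in Ω, inner ℝ (dtD t x) (φ t x)
  -- `d × Δd ∈ L²(0,T; L²)` as the weak divergence of `d × ∇d`
  w_mem : MemLp (Function.uncurry w) 2 (cyl Ω T)
  w_spec : ∀ᵐ t ∂volume.restrict (Ioo 0 T), ∀ φ, IsTest Ω φ →
    ∫ x in Ω, inner ℝ (w t x) (φ x)
      = -∫ x in Ω, frob (crossMat (d t x) (gradD t x)) (grad φ x)
  -- `∂ₜd + (v·∇)d - (∇v)_{skw} d + (I - d ⊗ d)(λ (∇v)_{sym} d - Δd) = 0`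
  director_eq : ∀ᵐ z ∂cyl Ω T,
    dtD z.1 z.2 + mv (gradD z.1 z.2) (v z.1 z.2) - mv (skwPart (gradV z.1 z.2)) (d z.1 z.2)
      + (mv (1 - outer (d z.1 z.2) (d z.1 z.2))
          (c.lam • mv (symPart (gradV z.1 z.2)) (d z.1 z.2))
        - projLap (d z.1 z.2) (w z.1 z.2)) = 0

/-! ### Energy-variational solutions -/

/-- The regularity weight `𝒦(u) = 2 ‖(∇u)_{sym,-}‖_{C(Ω̄)}` as a function of `G = ∇u`. It is only
used when `(∇u)_{sym,-}` has a continuous version on `Ω̄`; then the essential supremum over the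
open set `Ω` is the maximum over `Ω̄`. -/
def weight (Ω : Set E3) (G : E3 → Mat3) : ℝ :=
  2 * (eLpNorm (fun x => matSpectralNorm (symNegPart (G x))) ⊤ (vol Ω)).toReal

/-- `u ∈ C¹([0,T]; (H¹_{0,σ})*) ∩ L²(0,T; H¹_{0,σ})` with `𝒦(u) ∈ L¹(0,T)`. Here `G = ∇u`, and
`L t` is `u(t)` as an element of the dual space. Such `u` lie in `C([0,T]; L²_σ)`, so `u(t)` is
required to be in `L²_σ` for all `t`. -/
structure IsAdmissibleTest (Ω : Set E3) (T : ℝ) (u : ℝ → E3 → E3) (G : ℝ → E3 → Mat3)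
    (L : ℝ → (H10sigma Ω →L[ℝ] ℝ)) : Prop where
  mem : MemLp (Function.uncurry u) 2 (cyl Ω T)
  grad_mem : ∀ i j, MemLp (fun z : ℝ × E3 => G z.1 z.2 i j) 2 (cyl Ω T)
  mem_H1 : ∀ᵐ t ∂volume.restrict (Ioo 0 T), MemH10sigma Ω (u t) (G t)
  mem_L2sigma : ∀ t ∈ Icc 0 T, MemL2sigma Ω (u t)
  dual_eq : ∀ t ∈ Icc 0 T, ∀ p : H10sigma Ω,
    L t p = ∫ x in Ω, inner ℝ (u t x) ((p : H1Pair Ω).1 x)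
  dual_C1 : ContDiffOn ℝ 1 L (Icc 0 T)
  weight_cont : ∀ᵐ t ∂volume.restrict (Ioo 0 T), ∃ N : E3 → Mat3,
    ContinuousOn N (closure Ω) ∧ N =ᵐ[vol Ω] fun x => symNegPart (G t x)
  weight_int : IntegrableOn (fun t => weight Ω (G t)) (Ioo 0 T)

/-- The left limit `E(s-)`, with `E(0-) = E(0)`. -/
def leftValue (E : ℝ → ℝ) (s : ℝ) : ℝ := if s = 0 then E 0 else Function.leftLim E s

/-- The energy-variational inequality on `[s,t]` for the test field `u`, `G = ∇u`, `L = u` as a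
curve in the dual space. The Ericksen stress is `∫ (∇dᵀ ∇d) : ∇u`. -/
def EnergyVariationalInequality {Ω : Set E3} {T : ℝ} {c : Coefficients} {v d : ℝ → E3 → E3}
    (F : FlowFields Ω T c v d) (E : ℝ → ℝ) (u : ℝ → E3 → E3) (G : ℝ → E3 → Mat3)
    (L : ℝ → (H10sigma Ω →L[ℝ] ℝ)) (s t : ℝ) : Prop :=
  ((E t - ∫ x in Ω, inner ℝ (v t x) (u t x))
      - (leftValue E s - ∫ x in Ω, inner ℝ (v s x) (u s x)))
    + (∫ τ in s..t, derivWithin L (Icc 0 T) τ (toH10sigma Ω (v τ) (F.gradV τ)))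
    + (∫ τ in s..t, ∫ x in Ω,
        (-inner ℝ (mv (F.gradV τ x) (v τ x)) (u τ x)
          + frob ((F.gradD τ x)ᵀ * F.gradD τ x) (G τ x)
          + frob (stressD c (d τ x) (F.gradV τ x)) (F.gradV τ x - G τ x)
          + ‖F.w τ x‖ ^ 2
          - frob (stressElastic c (d τ x) (F.w τ x)) (G τ x)))
    + (∫ τ in s..t, weight Ω (G τ) * (energy Ω (v τ) (d τ) - E τ)) ≤ 0

/-- `(v, d, E)` is an energy-variational solution on `[0,T]` with initial values `v₀`, `d₀` and
boundary values of the director given by the trace of `dΓ`, for the regularity weight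
`𝒦(u) = 2 ‖(∇u)_{sym,-}‖_{C(Ω̄)}`. -/
def IsEnergyVariationalSolution (Ω : Set E3) (T : ℝ) (c : Coefficients) (v₀ d₀ dΓ : E3 → E3)
    (v d : ℝ → E3 → E3) (E : ℝ → ℝ) : Prop :=
  BoundedVariationOn E (Icc 0 T) ∧
  (∀ t ∈ Icc 0 T, energy Ω (v t) (d t) ≤ E t) ∧
  v 0 =ᵐ[vol Ω] v₀ ∧ d 0 =ᵐ[vol Ω] d₀ ∧
  (∀ᵐ t ∂volume.restrict (Ioo 0 T), MemH10 Ω fun x => d t x - dΓ x) ∧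
  ∃ F : FlowFields Ω T c v d, ∀ u G L, IsAdmissibleTest Ω T u G L →
    ∀ s t, 0 ≤ s → s < t → t < T → EnergyVariationalInequality F E u G L s t

/-! ### Measure-valued solutions -/

theorem continuous_entry (i j : Fin 3) : Continuous (Matrix.entryAddMonoidHom ℝ i j : Mat3 →+ ℝ) :=
  continuous_id.matrix_elem i j

/-- The entry `m_{ij}` of a matrix-valued measure, a signed measure. -/
def entry (m : VectorMeasure E3 Mat3) (i j : Fin 3) : SignedMeasure E3 :=
  m.mapRange (Matrix.entryAddMonoidHom ℝ i j) (continuous_entry i j)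

theorem entry_apply (m : VectorMeasure E3 Mat3) (i j : Fin 3) (B : Set E3) :
    entry m i j B = m B i j :=
  VectorMeasure.mapRange_apply m (continuous_entry i j)

/-- `∫ A : dm = ∑_{i,j} ∫ A_{ij} dm_{ij}`. -/
def matInt (m : VectorMeasure E3 Mat3) (A : E3 → Mat3) : ℝ :=
  ∑ i, ∑ j, ∫ᵛ x, A x i j ∂•(entry m i j)

/-- `m ∈ L^∞_{w*}(0,T; ℳ(Ω̄; ℝ^{3×3}_{sym,+}))`. -/
structure IsDefectMeasure (Ω : Set E3) (T : ℝ) (m : ℝ → VectorMeasure E3 Mat3) : Prop where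
  /-- The measures live on `Ω̄`. -/
  supported : ∀ t ∈ Ioo 0 T, ∀ B, MeasurableSet B → Disjoint B (closure Ω) → m t B = 0
  /-- The values are positive semidefinite symmetric matrices. -/
  posSemidef : ∀ t ∈ Ioo 0 T, ∀ B, MeasurableSet B → (m t B).PosSemidef
  /-- Weak-star measurability in time. -/
  measurable : ∀ A : E3 → Mat3, ContinuousOn A (closure Ω) →
    AEStronglyMeasurable (fun t => matInt (m t) A) (volume.restrict (Ioo 0 T))
  /-- Essential boundedness of the norm dual to that of `C(Ω̄)`. -/
  bounded : ∃ C : ℝ, ∀ᵐ t ∂volume.restrict (Ioo 0 T), ∀ A : E3 → Mat3,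
    ContinuousOn A (closure Ω) → (∀ x ∈ closure Ω, matSpectralNorm (A x) ≤ 1) →
      |matInt (m t) A| ≤ C

/-- `(v, d, m)` is a measure-valued solution on `[0,T]`. -/
def IsMeasureValuedSolution (Ω : Set E3) (T : ℝ) (c : Coefficients) (v d : ℝ → E3 → E3)
    (m : ℝ → VectorMeasure E3 Mat3) : Prop :=
  IsDefectMeasure Ω T m ∧
  ∃ F : FlowFields Ω T c v d,
    (∀ φ, IsSpaceTimeTest Ω T φ → (∀ t x, (grad (φ t) x).trace = 0) →
      ∫ t in (0 : ℝ)..T,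
        ((∫ x in Ω,
            (frob (stressL c (d t x) (F.gradV t x) (F.w t x)) (grad (φ t) x)
              - frob (outer (v t x) (v t x) + (F.gradD t x)ᵀ * F.gradD t x) (grad (φ t) x)
              - inner ℝ (v t x) (deriv (fun s => φ s x) t)))
          - 2 * matInt (m t) (fun x => symPart (grad (φ t) x))) = 0) ∧
    (∀ᵐ t ∂volume.restrict (Ioo 0 T),
      (energy Ω (v t) (d t) + 1 / 2 * matInt (m t) (fun _ => 1)) - energy Ω (v 0) (d 0)
        + (∫ τ in (0 : ℝ)..t, ∫ x in Ω,
            (frob (stressD c (d τ x) (F.gradV τ x)) (symPart (F.gradV τ x)) + ‖F.w τ x‖ ^ 2))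
        ≤ 0)

end EricksenLeslie

end

noncomputable section

namespace EricksenLeslie

/-! ### Matrices -/

section

open scoped Matrix.Norms.L2Operator

/-! Put `f = E - ℰ(v,d) ≥ 0`. In the energy-variational inequality take the test field `-φ`, with
`φ` solenoidal and compactly supported in `Ω × (0,T)`, from time `0` to a time after which `φ`
vanishes. Up to terms that do not depend on `φ`, the weak momentum balance `ℓ(φ)` is then bounded by
`∫ 𝒦(-φ) f`. Replacing `φ` by `rφ` and letting `r → ∞` removes the other terms
(`FlowFields.momentumFunctional_le`). The spectral norm of the negative part of `-(∇φ)_sym` is the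
maximum over unit vectors `ξ` of the positive part of `ξ · ∇φ ξ`, hence `½ ℓ(φ) ≤ ∫ f(t) max_{x,ξ}
(ξ · ∇φ(t,x) ξ)⁺ dt`.

The right side is a sublinear functional of the scalar function `(t, x, ξ) ↦ ξ · ∇φ(t,x) ξ` on `ℝ ×
Ω̄ × 𝕊²`. By Hahn–Banach, `½ ℓ` extends to all compactly supported continuous functions under the
same bound. The bound is zero on nonpositive functions, so the extension is positive and is a
measure by Riesz. Its time marginal is at most `f dt`, and disintegration writes it as `k(t) dt ⊗
κ_t` with probability measures `κ_t` and `0 ≤ k ≤ f` (`exists_kernel_representation`).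

The defect is `m_t = k(t) ∫ ξ ⊗ ξ dκ_t`. It is positive semidefinite by construction, and its total
trace is `k(t)` because `|ξ| = 1`. The representation of `½ ℓ` is the momentum balance with defect,
and the test field `0` gives the energy inequality. Working with directions `ξ` instead of
matrix-valued functions makes the positivity of `m` automatic. -/

theorem symNegPart_eq_cfc (A : Mat3) : symNegPart A = cfc (fun r : ℝ => min r 0) (symPart A) :=
  ((symPart_isHermitian A).cfc_eq _).symm

theorem continuous_symPart : Continuous symPart := by
  unfold symPart
  fun_prop

/-- Eigenvectors need not depend continuously on the matrix, but the functional calculus of the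
continuous function `r ↦ min r 0` does. -/
theorem continuous_symNegPart : Continuous symNegPart := by
  have : symNegPart = fun A => cfc (fun r : ℝ => min r 0) (symPart A) :=
    funext symNegPart_eq_cfc
  rw [this]
  exact Continuous.cfc_of_mem_nhdsSet (s := univ) _ univ_mem continuous_symPart
    (fun x => symPart_isHermitian x) (by fun_prop)

theorem matSpectralNorm_eq_norm (A : Mat3) : matSpectralNorm A = ‖A‖ :=
  (Matrix.l2_opNorm_def A).symm

theorem continuous_matSpectralNorm : Continuous matSpectralNorm := by
  have : matSpectralNorm = fun A => ‖A‖ := funext matSpectralNorm_eq_norm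
  rw [this]
  exact continuous_norm

theorem matSpectralNorm_nonneg (A : Mat3) : 0 ≤ matSpectralNorm A := norm_nonneg _

theorem frob_outer (A : Mat3) (a b : E3) : frob A (outer a b) = inner ℝ a (mv A b) := by
  simp only [frob, outer, mv, Matrix.of_apply, PiLp.inner_apply, Matrix.mulVec, dotProduct,
    Fin.sum_univ_three, RCLike.inner_apply, conj_trivial]
  ring

theorem frob_symPart_outer (A : Mat3) (a : E3) : frob (symPart A) (outer a a) = frob A (outer a a) := by
  simp only [frob, outer, symPart, Matrix.of_apply, Matrix.smul_apply, Matrix.add_apply,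
    Matrix.transpose_apply, Fin.sum_univ_three, smul_eq_mul]
  ring

/-- The eigenvalues of `(-A)_sym` are the numbers `-ξ · Aξ` at unit eigenvectors `ξ`, so their
negative parts are controlled by an upper bound for the quadratic form of `A`. This turns the
regularity weight into a maximum over directions. -/
theorem matSpectralNorm_symNegPart_neg_le (A : Mat3) {C : ℝ} (hC : 0 ≤ C)
    (h : ∀ ξ : E3, ‖ξ‖ = 1 → frob A (outer ξ ξ) ≤ C) :
    matSpectralNorm (symNegPart (-A)) ≤ C := by
  rw [matSpectralNorm_eq_norm, symNegPart_eq_cfc]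
  refine norm_cfc_le hC fun x hx => ?_
  have hH := symPart_isHermitian (-A)
  rw [hH.spectrum_real_eq_range_eigenvalues] at hx
  obtain ⟨i, rfl⟩ := hx
  have h1 := h (hH.eigenvectorBasis i) (hH.eigenvectorBasis.orthonormal.1 i)
  have h2 : hH.eigenvalues i = -frob A (outer (hH.eigenvectorBasis i) (hH.eigenvectorBasis i)) := by
    rw [hH.eigenvalues_eq, ← frob_symPart_outer]
    simp only [frob, outer, symPart, Matrix.of_apply, Matrix.smul_apply, Matrix.add_apply,
      Matrix.neg_apply, dotProduct, Matrix.mulVec, Pi.star_apply, star_trivial, RCLike.re_to_real,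
      Matrix.transpose_apply, Fin.sum_univ_three, smul_eq_mul]
    ring
  rw [h2, Real.norm_eq_abs, abs_le]
  constructor
  · rw [le_min_iff]
    constructor <;> linarith
  · exact (min_le_right _ _).trans hC

theorem frob_outer_le (A : Mat3) (ξ : E3) (hξ : ‖ξ‖ = 1) :
    |frob A (outer ξ ξ)| ≤ matSpectralNorm A := by
  rw [frob_outer]
  refine (abs_real_inner_le_norm _ _).trans ?_
  rw [hξ, one_mul]
  have : mv A ξ = Matrix.toEuclideanCLM (n := Fin 3) (𝕜 := ℝ) A ξ := by
    ext i
    simp [mv, ← Matrix.ofLp_toEuclideanCLM]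
  rw [this]
  refine (ContinuousLinearMap.le_opNorm _ _).trans ?_
  rw [hξ, mul_one, matSpectralNorm]

end

theorem posSemidef_of_quadratic {M : Mat3} (hM : Mᵀ = M)
    (h : ∀ a : Fin 3 → ℝ, 0 ≤ ∑ i, ∑ j, a i * a j * M i j) : M.PosSemidef := by
  refine Matrix.PosSemidef.of_dotProduct_mulVec_nonneg ?_ fun x => ?_
  · rw [Matrix.IsHermitian, Matrix.conjTranspose_eq_transpose_of_trivial, hM]
  · refine (h x).trans_eq ?_
    simp only [dotProduct, Matrix.mulVec, star_trivial, Fin.sum_univ_three]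
    ring

/-! ### Signed and matrix-valued measures given by a density on a fibre space -/

section

variable {X Y : Type*} [MeasurableSpace X] [MeasurableSpace Y]

/-- Domination of the variation by `ν.map π` lets integrability, and equality almost everywhere,
pass from the positive measure to the signed one. -/
theorem variation_map_withDensityᵥ_le {ν : Measure Y} [IsFiniteMeasure ν] {g : Y → ℝ}
    (hg : Integrable g ν) (hg1 : ∀ y, |g y| ≤ 1) {π : Y → X} (hπ : Measurable π) :
    ((ν.withDensityᵥ g).map π).variation ≤ ν.map π := by
  refine VectorMeasure.variation_le_of_forall_enorm_le fun B hB => ?_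
  rw [VectorMeasure.map_apply _ hπ hB, withDensityᵥ_apply hg (hπ hB), Measure.map_apply hπ hB]
  refine (enorm_integral_le_lintegral_enorm _).trans ?_
  calc ∫⁻ y in π ⁻¹' B, ‖g y‖ₑ ∂ν ≤ ∫⁻ _ in π ⁻¹' B, 1 ∂ν := by
        refine lintegral_mono fun y => ?_
        rw [← ofReal_norm]
        exact ENNReal.ofReal_le_one.2 (hg1 y)
    _ = ν (π ⁻¹' B) := by simp

/-- Proved by induction over integrable functions: both sides are linear and agree on indicators,
and both are continuous in `L¹(ν.map π)`. -/
theorem integral_map_withDensityᵥ {ν : Measure Y} [IsFiniteMeasure ν] {g : Y → ℝ}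
    (hg : Integrable g ν) (hg1 : ∀ y, |g y| ≤ 1) {π : Y → X} (hπ : Measurable π)
    {f : X → ℝ} (hf : Integrable f (ν.map π)) :
    ∫ᵛ x, f x ∂•((ν.withDensityᵥ g).map π) = ∫ y, f (π y) * g y ∂ν := by
  have hle := variation_map_withDensityᵥ_le hg hg1 hπ
  have hfin : IsFiniteMeasure ((ν.withDensityᵥ g).map π).variation := isFiniteMeasure_of_le _ hle
  have hmul : ∀ {u : X → ℝ}, Integrable u (ν.map π) → Integrable (fun y => u (π y) * g y) ν :=
    fun {u} hu => (hu.comp_measurable hπ).mul_bdd (c := 1) hg.1 (Eventually.of_forall hg1)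
  refine Integrable.induction (μ := ν.map π) (fun u : X → ℝ =>
    ∫ᵛ x, u x ∂•((ν.withDensityᵥ g).map π) = ∫ y, u (π y) * g y ∂ν) ?_ ?_ ?_ ?_ hf
  · intro c s hs _
    have h1 : (fun x => s.indicator (fun _ => c) x) = fun x => c • s.indicator (fun _ => (1 : ℝ)) x := by
      ext x
      by_cases hx : x ∈ s <;> simp [hx]
    rw [show (∫ᵛ x, s.indicator (fun _ => c) x ∂•((ν.withDensityᵥ g).map π))
      = c • ∫ᵛ x, s.indicator (fun _ => (1 : ℝ)) x ∂•((ν.withDensityᵥ g).map π) by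
        rw [← VectorMeasure.integral_fun_smul, h1]]
    rw [VectorMeasure.integral_eq_setToFun, setToFun_indicator_const _ hs (measure_ne_top _ _)]
    rw [show (∫ y, s.indicator (fun _ => c) (π y) * g y ∂ν) = ∫ y, (π ⁻¹' s).indicator (fun y => c * g y) y ∂ν by
      refine integral_congr_ae (Eventually.of_forall fun y => ?_)
      by_cases hy : π y ∈ s <;> simp [hy]]
    rw [integral_indicator (hπ hs), integral_const_mul, ← withDensityᵥ_apply hg (hπ hs),
      ← VectorMeasure.map_apply _ hπ hs]
    change c • ContinuousLinearMap.lsmul ℝ ℝ (1 : ℝ) (((ν.withDensityᵥ g).map π) s) = _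
    simp
  · intro f f' _ hf hg' ihf ihg
    rw [VectorMeasure.integral_add (hf.mono_measure hle) (hg'.mono_measure hle), ihf, ihg,
      ← integral_add (hmul hf) (hmul hg')]
    refine integral_congr_ae (Eventually.of_forall fun y => ?_)
    simp [add_mul]
  -- Since `|g| ≤ 1`, both sides are 1-Lipschitz in the `L¹` norm; hence the set where they agree is
  -- closed.
  · have key : ∀ u u' : Lp ℝ 1 (ν.map π),
        |(∫ᵛ x, u x ∂•((ν.withDensityᵥ g).map π)) - ∫ᵛ x, u' x ∂•((ν.withDensityᵥ g).map π)| ≤ ‖u - u'‖ ∧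
        |(∫ y, u (π y) * g y ∂ν) - ∫ y, u' (π y) * g y ∂ν| ≤ ‖u - u'‖ := by
      intro u u'
      have hu := L1.integrable_coeFn u
      have hu' := L1.integrable_coeFn u'
      have hn : ‖u - u'‖ = ∫ x, |u x - u' x| ∂(ν.map π) := by
        rw [L1.norm_eq_integral_norm]
        refine integral_congr_ae ?_
        filter_upwards [Lp.coeFn_sub u u'] with x hx
        rw [hx]; rfl
      constructor
      · rw [← VectorMeasure.integral_fun_sub (hu.mono_measure hle) (hu'.mono_measure hle), hn]
        rw [← Real.norm_eq_abs]
        refine (VectorMeasure.norm_integral_le_integral_norm).trans ?_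
        have hB : ‖ContinuousLinearMap.lsmul ℝ ℝ (E := ℝ)‖ ≤ 1 := ContinuousLinearMap.opNorm_lsmul_le
        refine (mul_le_of_le_one_left (integral_nonneg fun _ => norm_nonneg _) hB).trans ?_
        exact integral_mono_measure hle (Eventually.of_forall fun _ => norm_nonneg _)
          (hu.sub hu').norm
      · rw [← integral_sub (hmul hu) (hmul hu'), hn]
        have hm := integral_map hπ.aemeasurable (hu.sub hu').abs.1
        simp only [Pi.sub_apply] at hm
        rw [hm]
        refine (abs_integral_le_integral_abs).trans ?_
        refine integral_mono_of_nonneg (Eventually.of_forall fun _ => abs_nonneg _)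
          ((hu.sub hu').abs.comp_measurable hπ) (Eventually.of_forall fun y => ?_)
        simp only
        rw [← sub_mul, abs_mul]
        exact mul_le_of_le_one_right (abs_nonneg _) (hg1 y)
    have c1 : Continuous fun u : Lp ℝ 1 (ν.map π) => ∫ᵛ x, u x ∂•((ν.withDensityᵥ g).map π) :=
      (LipschitzWith.of_dist_le_mul (K := 1) fun u u' => by
        simpa [Real.dist_eq, dist_eq_norm] using (key u u').1).continuous
    have c2 : Continuous fun u : Lp ℝ 1 (ν.map π) => ∫ y, u (π y) * g y ∂ν :=
      (LipschitzWith.of_dist_le_mul (K := 1) fun u u' => by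
        simpa [Real.dist_eq, dist_eq_norm] using (key u u').2).continuous
    exact isClosed_eq c1 c2
  · intro f f' hff' _ ih
    rw [← VectorMeasure.integral_congr_ae (hff'.filter_mono (ae_mono hle)), ih]
    refine integral_congr_ae ?_
    filter_upwards [ae_of_ae_map hπ.aemeasurable hff'] with y hy
    rw [hy]

end

/-! ### Second moments of a field of unit directions -/

section

variable {Y : Type*} [MeasurableSpace Y]

/-- The matrix-valued measure `B ↦ ∫_{π⁻¹ B} ξ ⊗ ξ dν`. -/
def secondMoment (ν : Measure Y) (π ξ : Y → E3) : VectorMeasure E3 Mat3 where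
  measureOf' B := Matrix.of fun i j => ((ν.withDensityᵥ fun y => ξ y i * ξ y j).map π) B
  empty' := by ext; simp
  not_measurable' B hB := by ext; simp [VectorMeasure.not_measurable _ hB]
  m_iUnion' B hB hd := by
    refine Pi.hasSum.2 fun i => Pi.hasSum.2 fun j => ?_
    exact ((ν.withDensityᵥ fun y => ξ y i * ξ y j).map π).m_iUnion hB hd

variable {ν : Measure Y} {π ξ : Y → E3}

theorem entry_secondMoment (i j : Fin 3) :
    entry (secondMoment ν π ξ) i j = (ν.withDensityᵥ fun y => ξ y i * ξ y j).map π := by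
  ext B hB
  rw [entry_apply]
  rfl

variable [IsFiniteMeasure ν]

theorem abs_apply_mul_apply_le (x : E3) (hx : ‖x‖ = 1) (i j : Fin 3) : |x i * x j| ≤ 1 := by
  have h := fun k => hx ▸ PiLp.norm_apply_le x k
  rw [abs_mul]
  exact mul_le_one₀ (h i) (abs_nonneg _) (h j)

theorem integrable_moment (hξ : Measurable ξ) (hξ1 : ∀ y, ‖ξ y‖ = 1) (i j : Fin 3) :
    Integrable (fun y => ξ y i * ξ y j) ν := by
  refine Integrable.of_bound (C := 1) (by fun_prop) (Eventually.of_forall fun y => ?_)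
  exact abs_apply_mul_apply_le _ (hξ1 y) i j

theorem secondMoment_apply (hπ : Measurable π) (hξ : Measurable ξ) (hξ1 : ∀ y, ‖ξ y‖ = 1)
    {B : Set E3} (hB : MeasurableSet B) (i j : Fin 3) :
    secondMoment ν π ξ B i j = ∫ y in π ⁻¹' B, ξ y i * ξ y j ∂ν := by
  rw [← withDensityᵥ_apply (integrable_moment hξ hξ1 i j) (hπ hB), ← VectorMeasure.map_apply _ hπ hB]
  rfl

/-- The quadratic form at `a` is `∫ (a · ξ)² dν` over `π ⁻¹' B`. -/
theorem posSemidef_secondMoment (hπ : Measurable π) (hξ : Measurable ξ) (hξ1 : ∀ y, ‖ξ y‖ = 1)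
    {B : Set E3} (hB : MeasurableSet B) : (secondMoment ν π ξ B).PosSemidef := by
  refine posSemidef_of_quadratic ?_ fun a => ?_
  · ext i j
    simp only [Matrix.transpose_apply, secondMoment_apply hπ hξ hξ1 hB, mul_comm]
  · have hi := fun i j => (integrable_moment (ν := ν) hξ hξ1 i j).integrableOn (s := π ⁻¹' B)
    simp only [secondMoment_apply hπ hξ hξ1 hB, ← integral_const_mul]
    simp only [← integral_finsetSum _ fun j _ => (hi _ j).const_mul _]
    rw [← integral_finsetSum _ fun i _ => integrable_finsetSum _ fun j _ => (hi i j).const_mul _]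
    refine integral_nonneg fun y => ?_
    have : (∑ i, ∑ j, a i * a j * (ξ y i * ξ y j)) = (∑ i, a i * ξ y i) ^ 2 := by
      simp only [Fin.sum_univ_three]
      ring
    simp only [this]
    positivity

theorem matInt_secondMoment (hπ : Measurable π) (hξ : Measurable ξ) (hξ1 : ∀ y, ‖ξ y‖ = 1)
    {K : Set E3} (hK : IsCompact K) (hπK : ∀ y, π y ∈ K) {A : E3 → Mat3} (hA : ContinuousOn A K) :
    matInt (secondMoment ν π ξ) A = ∫ y, frob (A (π y)) (outer (ξ y) (ξ y)) ∂ν := by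
  have hAij : ∀ i j, ContinuousOn (fun x => A x i j) K := fun i j =>
    (continuous_entry i j).comp_continuousOn hA
  -- `A` is controlled on `K` only; this suffices because the pushforward is carried by `K`.
  have hmem : ∀ᵐ x ∂ν.map π, x ∈ K := by
    rw [ae_map_iff (p := fun x => x ∈ K) hπ.aemeasurable hK.measurableSet]
    exact Eventually.of_forall hπK
  have hint : ∀ i j, Integrable (fun x => A x i j) (ν.map π) := fun i j => by
    rw [← Measure.restrict_eq_self_of_ae_mem hmem]
    exact (hAij i j).integrableOn_compact hK
  have hi : ∀ i j, Integrable (fun y => A (π y) i j * (ξ y i * ξ y j)) ν := fun i j =>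
    ((hint i j).comp_measurable hπ).mul_bdd (c := 1) (integrable_moment hξ hξ1 i j).1
      (Eventually.of_forall fun y => abs_apply_mul_apply_le _ (hξ1 y) i j)
  simp only [matInt, entry_secondMoment, frob, outer, Matrix.of_apply]
  rw [integral_finsetSum _ fun i _ => integrable_finsetSum _ fun j _ => hi i j]
  refine Finset.sum_congr rfl fun i _ => ?_
  rw [integral_finsetSum _ fun j _ => hi i j]
  refine Finset.sum_congr rfl fun j _ => ?_
  exact integral_map_withDensityᵥ (integrable_moment hξ hξ1 i j)
    (fun y => abs_apply_mul_apply_le _ (hξ1 y) i j) hπ (hint i j)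

end

/-! ### Sublinear functionals on continuous functions and their representation by kernels -/

section

open scoped CompactlySupported

/-- Hahn–Banach along a map `j` that need not be injective. If `j x = 0`, then `l x` and `l (-x)`
are both at most `N 0 = 0`, so `l` vanishes on the kernel and descends to the range of `j`. -/
theorem exists_linear_of_le_sublinear {V W : Type*} [AddCommGroup V] [Module ℝ V]
    [AddCommGroup W] [Module ℝ W] (j : V →ₗ[ℝ] W) (l : V →ₗ[ℝ] ℝ) (N : W → ℝ)
    (N_hom : ∀ c : ℝ, 0 < c → ∀ x, N (c • x) = c * N x) (N_add : ∀ x y, N (x + y) ≤ N x + N y)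
    (h : ∀ x, l x ≤ N (j x)) :
    ∃ L : W →ₗ[ℝ] ℝ, (∀ x, L (j x) = l x) ∧ ∀ y, L y ≤ N y := by
  have N_0 : N 0 = 0 := by
    have := N_hom 2 (by norm_num) 0
    rw [smul_zero] at this
    linarith
  have hker : LinearMap.ker j ≤ LinearMap.ker l := fun x hx => by
    rw [LinearMap.mem_ker] at hx ⊢
    have h1 := h x
    have h2 := h (-x)
    rw [map_neg, map_neg, hx, neg_zero, N_0] at h2
    rw [hx, N_0] at h1
    linarith
  let f : W →ₗ.[ℝ] ℝ :=
    ⟨LinearMap.range j, (LinearMap.ker j).liftQ l hker ∘ₗ (j.quotKerEquivRange.symm : _ →ₗ[ℝ] _)⟩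
  have hf : ∀ x, f ⟨j x, LinearMap.mem_range_self j x⟩ = l x := fun x => by
    change (LinearMap.ker j).liftQ l hker (j.quotKerEquivRange.symm ⟨j x, _⟩) = l x
    rw [LinearMap.quotKerEquivRange_symm_apply_image]
    exact (LinearMap.ker j).liftQ_apply l x
  obtain ⟨L, hL, hLN⟩ := exists_extension_of_le_sublinear f N N_hom N_add (by
    rintro ⟨_, x, rfl⟩
    exact (hf x).trans_le (h x))
  exact ⟨L, fun x => (hL ⟨j x, LinearMap.mem_range_self j x⟩).trans (hf x), hLN⟩

/-! ### The maximum of the positive part as a sublinear functional -/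

variable {Y : Type*} [TopologicalSpace Y]

/-- The section `g(t, ·)`. -/
def slice (g : C_c(ℝ × Y, ℝ)) (t : ℝ) : C(Y, ℝ) := g.toContinuousMap.curry t

theorem continuous_slice (g : C_c(ℝ × Y, ℝ)) : Continuous (slice g) := g.toContinuousMap.curry.2

variable [CompactSpace Y]

/-- The maximum of the positive part of a continuous function on a compact space. -/
def posSup (u : C(Y, ℝ)) : ℝ := ‖u ⊔ 0‖

theorem posSup_nonneg (u : C(Y, ℝ)) : 0 ≤ posSup u := norm_nonneg _

theorem le_posSup (u : C(Y, ℝ)) (y : Y) : u y ≤ posSup u :=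
  calc u y ≤ (u ⊔ 0) y := le_sup_left
    _ ≤ ‖(u ⊔ 0) y‖ := le_abs_self _
    _ ≤ posSup u := ContinuousMap.norm_coe_le_norm _ y

theorem posSup_le {u : C(Y, ℝ)} {C : ℝ} (hC : 0 ≤ C) (h : ∀ y, u y ≤ C) : posSup u ≤ C := by
  refine (ContinuousMap.norm_le _ hC).2 fun y => ?_
  rw [Real.norm_eq_abs, abs_of_nonneg (show (0 : ℝ) ≤ (u ⊔ 0) y from le_sup_right)]
  exact sup_le (h y) hC

theorem posSup_le_norm (u : C(Y, ℝ)) : posSup u ≤ ‖u‖ :=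
  posSup_le (norm_nonneg _) fun y => (le_abs_self _).trans (u.norm_coe_le_norm y)

theorem posSup_add_le (u w : C(Y, ℝ)) : posSup (u + w) ≤ posSup u + posSup w :=
  posSup_le (add_nonneg (posSup_nonneg _) (posSup_nonneg _)) fun y =>
    add_le_add (le_posSup u y) (le_posSup w y)

theorem posSup_smul {c : ℝ} (hc : 0 < c) (u : C(Y, ℝ)) : posSup (c • u) = c * posSup u := by
  have key : ∀ {a : ℝ} (_ : 0 < a) (w : C(Y, ℝ)), posSup (a • w) ≤ a * posSup w := fun {a} ha w =>
    posSup_le (mul_nonneg ha.le (posSup_nonneg _)) fun y => by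
      simpa using mul_le_mul_of_nonneg_left (le_posSup w y) ha.le
  refine le_antisymm (key hc u) ?_
  have h := key (inv_pos.2 hc) (c • u)
  rw [smul_smul, inv_mul_cancel₀ hc.ne', one_smul] at h
  rwa [le_inv_mul_iff₀ hc] at h

theorem posSup_of_nonpos {u : C(Y, ℝ)} (h : ∀ y, u y ≤ 0) : posSup u = 0 :=
  le_antisymm (posSup_le le_rfl h) (posSup_nonneg _)

theorem continuous_posSup : Continuous (posSup : C(Y, ℝ) → ℝ) := by
  refine (LipschitzWith.of_le_add fun u w => ?_).continuous
  calc posSup u = posSup (w + (u - w)) := by rw [add_sub_cancel]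
    _ ≤ posSup w + posSup (u - w) := posSup_add_le _ _
    _ ≤ posSup w + dist u w := by
      rw [dist_eq_norm]
      exact add_le_add_right (posSup_le_norm _) _

theorem exists_norm_slice_le (g : C_c(ℝ × Y, ℝ)) : ∃ C, ∀ t, ‖slice g t‖ ≤ C := by
  obtain ⟨C, hC⟩ := g.hasCompactSupport.exists_bound_of_continuous g.continuous
  refine ⟨max C 0, fun t => (ContinuousMap.norm_le _ (le_max_right _ _)).2 fun y => ?_⟩
  exact (hC (t, y)).trans (le_max_left _ _)

/-! ### Its weighted integral over time -/

variable (ρ : Measure ℝ) (f : ℝ → ℝ)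

/-- `∫ f(t) max_y g(t, y)⁺ dρ(t)`. -/
def weightedPosSup (g : C_c(ℝ × Y, ℝ)) : ℝ := ∫ t, f t * posSup (slice g t) ∂ρ

variable {ρ f}

theorem integrable_mul_posSup (hf : Integrable f ρ) (g : C_c(ℝ × Y, ℝ)) :
    Integrable (fun t => f t * posSup (slice g t)) ρ := by
  obtain ⟨C, hC⟩ := exists_norm_slice_le g
  refine hf.mul_bdd (c := C) (continuous_posSup.comp (continuous_slice g)).aestronglyMeasurable
    (Eventually.of_forall fun t => ?_)
  rw [Real.norm_eq_abs, abs_of_nonneg (posSup_nonneg _)]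
  exact (posSup_le_norm _).trans (hC t)

theorem weightedPosSup_smul {c : ℝ} (hc : 0 < c) (g : C_c(ℝ × Y, ℝ)) :
    weightedPosSup ρ f (c • g) = c * weightedPosSup ρ f g := by
  rw [weightedPosSup, weightedPosSup, ← integral_const_mul]
  refine integral_congr_ae (Eventually.of_forall fun t => ?_)
  have : slice (c • g) t = c • slice g t := rfl
  simp only [this, posSup_smul hc]
  ring

theorem weightedPosSup_add_le (hf : Integrable f ρ) (hf0 : 0 ≤ᵐ[ρ] f) (g g' : C_c(ℝ × Y, ℝ)) :
    weightedPosSup ρ f (g + g') ≤ weightedPosSup ρ f g + weightedPosSup ρ f g' := by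
  rw [weightedPosSup, weightedPosSup, weightedPosSup,
    ← integral_add (integrable_mul_posSup hf g) (integrable_mul_posSup hf g')]
  refine integral_mono_ae (integrable_mul_posSup hf _)
    ((integrable_mul_posSup hf g).add (integrable_mul_posSup hf g')) ?_
  filter_upwards [hf0] with t ht
  rw [← mul_add]
  exact mul_le_mul_of_nonneg_left (posSup_add_le (slice g t) (slice g' t)) ht

/-- This is what forces positivity: a linear functional below `weightedPosSup` is nonpositive at
`-g` whenever `g ≥ 0`. -/
theorem weightedPosSup_of_nonpos {g : C_c(ℝ × Y, ℝ)} (hg : g ≤ 0) : weightedPosSup ρ f g = 0 := by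
  have : ∀ t, posSup (slice g t) = 0 := fun t => posSup_of_nonpos fun y => hg (t, y)
  simp [weightedPosSup, this]

variable [T2Space Y]

/-- A compactly supported function of the first variable, as a function on the product with a
compact space. -/
def liftFst (k : C(ℝ, ℝ)) (hk : HasCompactSupport k) : C_c(ℝ × Y, ℝ) where
  toFun z := k z.1
  hasCompactSupport' := by
    refine HasCompactSupport.intro (hk.isCompact.prod (isCompact_univ (X := Y))) fun z hz => ?_
    exact image_eq_zero_of_notMem_tsupport fun h => hz ⟨h, mem_univ _⟩

/-! ### Riesz representation, time marginal and disintegration -/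

variable [SecondCountableTopology Y] [MeasurableSpace Y] [BorelSpace Y]

/-- Test `L` with cutoff functions of time alone: if `0 ≤ k ≤ 1` vanishes off an open `V`, the
sublinear bound is at most `∫_V f`. Outer regularity of `f dρ` gives the comparison on compact sets,
and inner regularity of the marginal extends it to measurable sets. -/
theorem rieszMeasure_fst_le [IsFiniteMeasure ρ] (hf : Integrable f ρ) (hf0 : 0 ≤ᵐ[ρ] f)
    (L : C_c(ℝ × Y, ℝ) →ₚ[ℝ] ℝ) (hL : ∀ g, L g ≤ weightedPosSup ρ f g) :
    (RealRMK.rieszMeasure L).fst ≤ ρ.withDensity fun t => ENNReal.ofReal (f t) := by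
  set μ := RealRMK.rieszMeasure L
  set σ := ρ.withDensity fun t => ENNReal.ofReal (f t)
  have hσ : IsFiniteMeasure σ := isFiniteMeasure_withDensity_ofReal hf.2
  have hcompact : ∀ K : Set ℝ, IsCompact K → μ.fst K ≤ σ K := by
    intro K hK
    rw [hK.measure_eq_iInf_isOpen (μ := σ)]
    refine le_iInf₂ fun V hKV => le_iInf fun hV => ?_
    obtain ⟨k, hkK, hkV, hk, hk01⟩ := exists_continuous_one_zero_of_isCompact hK hV.isClosed_compl
      (disjoint_compl_right_iff_subset.2 hKV)
    rw [Measure.fst_apply hK.measurableSet]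
    have h1 := RealRMK.rieszMeasure_le_of_eq_one L (f := liftFst (Y := Y) k hk)
      (fun z => (hk01 z.1).1) (K := K ×ˢ univ) (hK.prod isCompact_univ)
      (fun z hz => hkK hz.1)
    rw [← prod_univ]
    refine h1.trans ?_
    have h2 : L (liftFst k hk) ≤ ∫ t in V, f t ∂ρ := by
      refine (hL _).trans ?_
      rw [← integral_indicator hV.measurableSet]
      refine integral_mono_ae (integrable_mul_posSup hf _) (hf.indicator hV.measurableSet) ?_
      filter_upwards [hf0] with t ht
      by_cases htV : t ∈ V
      · rw [indicator_of_mem htV]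
        exact mul_le_of_le_one_right ht (posSup_le zero_le_one fun y => (hk01 t).2)
      · rw [indicator_of_notMem htV, posSup_of_nonpos fun y => (hkV htV).le, mul_zero]
    refine (ENNReal.ofReal_le_ofReal h2).trans_eq ?_
    rw [ofReal_integral_eq_lintegral_ofReal hf.integrableOn (ae_restrict_of_ae hf0),
      withDensity_apply _ hV.measurableSet]
  -- Exhausting the line by compact intervals first shows that the marginal is finite; its inner
  -- regularity on measurable sets is then available.
  have hfin : IsFiniteMeasure μ.fst := by
    refine ⟨lt_of_le_of_lt ?_ (measure_lt_top σ univ)⟩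
    have hU : (⋃ n : ℕ, Icc (-(n : ℝ)) n) = univ := by
      refine eq_univ_of_forall fun x => mem_iUnion.2 ?_
      obtain ⟨n, hn⟩ := exists_nat_ge |x|
      exact ⟨n, abs_le.1 hn⟩
    have hmono : Monotone fun n : ℕ => Icc (-(n : ℝ)) n := fun a b hab =>
      Icc_subset_Icc (by simpa using hab) (by simpa using hab)
    rw [← hU, hmono.measure_iUnion]
    exact iSup_le fun n => (hcompact _ isCompact_Icc).trans (measure_mono (subset_iUnion (fun n : ℕ => Icc (-(n : ℝ)) n) n))
  refine Measure.le_intro fun s hs _ => ?_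
  rw [hs.measure_eq_iSup_isCompact]
  exact iSup₂_le fun K hK => iSup_le fun hKc => (hcompact K hKc).trans (measure_mono hK)

/-- The function `k` is the density of the time marginal and `κ` the conditional law of the fibre
variable given the time. As `κ` is Markov, `k` carries all the mass, and the bound on the marginal
becomes `k ≤ f`. -/
theorem exists_kernel_representation [StandardBorelSpace Y] [Nonempty Y] [IsFiniteMeasure ρ]
    (hf : Integrable f ρ) (hf0 : 0 ≤ᵐ[ρ] f) {V : Type*} [AddCommGroup V] [Module ℝ V]
    (j : V →ₗ[ℝ] C_c(ℝ × Y, ℝ)) (l : V →ₗ[ℝ] ℝ) (h : ∀ φ, l φ ≤ weightedPosSup ρ f (j φ)) :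
    ∃ (κ : ProbabilityTheory.Kernel ℝ Y) (k : ℝ → ℝ), ProbabilityTheory.IsMarkovKernel κ ∧
      Measurable k ∧ (∀ t, 0 ≤ k t) ∧ (∀ᵐ t ∂ρ, k t ≤ f t) ∧
      ∀ φ, Integrable (fun t => k t * ∫ y, j φ (t, y) ∂κ t) ρ ∧
        l φ = ∫ t, k t * ∫ y, j φ (t, y) ∂κ t ∂ρ := by
  obtain ⟨L₀, hL₀, hL₀N⟩ := exists_linear_of_le_sublinear j l (weightedPosSup ρ f)
    (fun c hc g => weightedPosSup_smul hc g) (weightedPosSup_add_le hf hf0) h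
  -- Positivity: the dominating functional is zero at `-g ≤ 0`, so `L₀ (-g) ≤ 0`.
  let L : C_c(ℝ × Y, ℝ) →ₚ[ℝ] ℝ := PositiveLinearMap.mk₀ L₀ fun g hg => by
    have h1 := hL₀N (-g)
    rw [weightedPosSup_of_nonpos (neg_nonpos.2 hg), map_neg] at h1
    linarith
  have hle := rieszMeasure_fst_le hf hf0 L hL₀N
  set μ := RealRMK.rieszMeasure L with hμ
  have hσ : IsFiniteMeasure (ρ.withDensity fun t => ENNReal.ofReal (f t)) :=
    isFiniteMeasure_withDensity_ofReal hf.2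
  have hμ1 : IsFiniteMeasure μ.fst := isFiniteMeasure_of_le _ hle
  have hμfin : IsFiniteMeasure μ := ⟨by
    have := measure_lt_top μ.fst univ
    rwa [Measure.fst_univ] at this⟩
  have hac : μ.fst ≪ ρ :=
    (Measure.absolutelyContinuous_of_le hle).trans (withDensity_absolutelyContinuous _ _)
  refine ⟨μ.condKernel, fun t => (μ.fst.rnDeriv ρ t).toReal, inferInstance,
    (Measure.measurable_rnDeriv _ _).ennreal_toReal, fun t => ENNReal.toReal_nonneg, ?_, ?_⟩
  · have : μ.fst.rnDeriv ρ ≤ᵐ[ρ] fun t => ENNReal.ofReal (f t) := by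
      refine ae_le_of_forall_setLIntegral_le_of_sigmaFinite (Measure.measurable_rnDeriv _ _)
        fun s hs _ => ?_
      rw [← withDensity_apply _ hs, Measure.withDensity_rnDeriv_eq _ _ hac, ← withDensity_apply _ hs]
      exact hle s
    filter_upwards [this, hf0] with t ht ht0
    exact ENNReal.toReal_le_of_le_ofReal ht0 ht
  · intro φ
    have hint : Integrable (j φ) μ := (j φ).integrable
    have hint' : Integrable (fun t => ∫ y, j φ (t, y) ∂μ.condKernel t) μ.fst := by
      rw [← μ.disintegrate μ.condKernel] at hint
      exact hint.integral_compProd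
    refine ⟨(integrable_rnDeriv_smul_iff hac).2 hint', ?_⟩
    have h2 := integral_rnDeriv_smul hac (f := fun t => ∫ y, j φ (t, y) ∂μ.condKernel t)
    simp only [smul_eq_mul] at h2
    rw [h2, Measure.integral_condKernel hint, hμ, RealRMK.integral_rieszMeasure]
    exact (hL₀ φ).symm

end

/-! ### Curves of continuous functions in `L^p` -/

section

variable {F : Type*} [NormedAddCommGroup F] {p : ℝ≥0∞} {μ : Measure E3}
  [IsFiniteMeasure μ] {φ ψ : ℝ → E3 → F}

theorem memLp_slice (hc : Continuous (Function.uncurry φ))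
    (hs : HasCompactSupport (Function.uncurry φ)) (t : ℝ) : MemLp (φ t) p μ := by
  obtain ⟨C, hC⟩ := hs.exists_bound_of_continuous hc
  have : Continuous (φ t) := hc.comp (by fun_prop : Continuous fun x : E3 => (t, x))
  exact MemLp.of_bound this.aestronglyMeasurable C (Eventually.of_forall fun x => hC (t, x))

variable (p μ) in
/-- The curve `t ↦ φ(t)` in `L^p`. -/
def toLpCurve (hc : Continuous (Function.uncurry φ)) (hs : HasCompactSupport (Function.uncurry φ))
    (t : ℝ) : Lp F p μ := (memLp_slice hc hs t).toLp (φ t)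

theorem coeFn_toLpCurve (hc : Continuous (Function.uncurry φ))
    (hs : HasCompactSupport (Function.uncurry φ)) (t : ℝ) : toLpCurve p μ hc hs t =ᵐ[μ] φ t :=
  MemLp.coeFn_toLp _

/-- Compact support gives uniform continuity, and on a finite measure space a uniform bound controls
every `L^p` norm. The case `p = ⊤` is included: there the exponent `p.toReal⁻¹` is `0` and `M = 1`.
-/
theorem continuous_toLpCurve [Fact (1 ≤ p)] (hc : Continuous (Function.uncurry φ))
    (hs : HasCompactSupport (Function.uncurry φ)) : Continuous (toLpCurve p μ hc hs) := by
  have hu := HasCompactSupport.uniformContinuous_of_continuous hs hc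
  set M : ℝ := measureUnivNNReal μ ^ p.toReal⁻¹ with hM
  have hM0 : 0 ≤ M := by positivity
  rw [Metric.continuous_iff]
  intro t ε hε
  obtain ⟨δ, hδ, h⟩ := Metric.uniformContinuous_iff.1 hu (ε / (M + 1)) (by positivity)
  refine ⟨δ, hδ, fun s hst => ?_⟩
  rw [dist_eq_norm]
  refine (Lp.norm_le_of_ae_bound (C := ε / (M + 1)) (by positivity) ?_).trans_lt ?_
  · filter_upwards [Lp.coeFn_sub (toLpCurve p μ hc hs s) (toLpCurve p μ hc hs t),
      coeFn_toLpCurve (p := p) (μ := μ) hc hs s, coeFn_toLpCurve (p := p) (μ := μ) hc hs t]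
      with x h1 h2 h3
    rw [h1, Pi.sub_apply, h2, h3, ← dist_eq_norm]
    refine (h (a := (s, x)) (b := (t, x)) ?_).le
    rw [Prod.dist_eq, dist_self]
    exact max_lt hst hδ
  · rw [← hM, mul_div_assoc', div_lt_iff₀ (by positivity)]
    nlinarith

variable [NormedSpace ℝ F]

theorem hasDerivAt_toLpCurve [Fact (1 ≤ p)] (hc : Continuous (Function.uncurry φ))
    (hs : HasCompactSupport (Function.uncurry φ)) (hc' : Continuous (Function.uncurry ψ))
    (hs' : HasCompactSupport (Function.uncurry ψ))
    (hd : ∀ t x, HasDerivAt (fun s => φ s x) (ψ t x) t) (t : ℝ) :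
    HasDerivAt (toLpCurve p μ hc hs) (toLpCurve p μ hc' hs' t) t := by
  have hu := HasCompactSupport.uniformContinuous_of_continuous hs' hc'
  set M : ℝ := measureUnivNNReal μ ^ p.toReal⁻¹ with hM
  have hM0 : 0 ≤ M := by positivity
  rw [hasDerivAt_iff_isLittleO, Asymptotics.isLittleO_iff]
  intro ε hε
  obtain ⟨δ, hδ, h⟩ := Metric.uniformContinuous_iff.1 hu (ε / (M + 1)) (by positivity)
  filter_upwards [Metric.ball_mem_nhds t hδ] with s hst
  refine (Lp.norm_le_of_ae_bound (C := ε / (M + 1) * ‖s - t‖) (by positivity) ?_).trans ?_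
  · filter_upwards [Lp.coeFn_sub (toLpCurve p μ hc hs s - toLpCurve p μ hc hs t)
        ((s - t) • toLpCurve p μ hc' hs' t),
      Lp.coeFn_sub (toLpCurve p μ hc hs s) (toLpCurve p μ hc hs t),
      Lp.coeFn_smul (s - t) (toLpCurve p μ hc' hs' t),
      coeFn_toLpCurve (p := p) (μ := μ) hc hs s, coeFn_toLpCurve (p := p) (μ := μ) hc hs t,
      coeFn_toLpCurve (p := p) (μ := μ) hc' hs' t]
      with x h0 h1 h2 h3 h4 h5
    rw [h0, Pi.sub_apply, h1, h2, Pi.sub_apply, Pi.smul_apply, h3, h4, h5]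
    -- Mean value inequality for `r ↦ φ r x - r • ψ t x`, whose derivative `ψ r x - ψ t x` is small
    -- uniformly in `x`.
    have key := Convex.norm_image_sub_le_of_norm_hasDerivWithin_le (𝕜 := ℝ)
      (f := fun r => φ r x - r • ψ t x) (f' := fun r => ψ r x - ψ t x)
      (C := ε / (M + 1)) (s := Metric.ball t δ) (x := t) (y := s)
      (fun r _ => ((hd r x).sub (by simpa using (hasDerivAt_id r).smul_const (ψ t x))).hasDerivWithinAt)
      (fun r hr => by
        rw [← dist_eq_norm]
        refine (h (a := (r, x)) (b := (t, x)) ?_).le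
        rw [Prod.dist_eq, dist_self]
        exact max_lt hr hδ)
      (convex_ball t δ) (Metric.mem_ball_self hδ) hst
    convert key using 2
    rw [sub_smul]
    abel
  · rw [← hM, ← mul_assoc]
    refine mul_le_mul_of_nonneg_right ?_ (norm_nonneg _)
    rw [mul_div_assoc', div_le_iff₀ (by positivity)]
    nlinarith

theorem contDiff_toLpCurve [Fact (1 ≤ p)] (hc : Continuous (Function.uncurry φ))
    (hs : HasCompactSupport (Function.uncurry φ)) (hc' : Continuous (Function.uncurry ψ))
    (hs' : HasCompactSupport (Function.uncurry ψ))
    (hd : ∀ t x, HasDerivAt (fun s => φ s x) (ψ t x) t) : ContDiff ℝ 1 (toLpCurve p μ hc hs) := by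
  have h := hasDerivAt_toLpCurve (p := p) (μ := μ) hc hs hc' hs' hd
  rw [contDiff_one_iff_deriv]
  refine ⟨fun t => (h t).differentiableAt, ?_⟩
  rw [funext fun t => (h t).deriv]
  exact continuous_toLpCurve hc' hs'

end

/-! ### Space-time test fields -/

section

variable {Ω : Set E3} {T : ℝ} {φ : ℝ → E3 → E3}

/-- The time derivative. -/
def timeDeriv (φ : ℝ → E3 → E3) (t : ℝ) (x : E3) : E3 := deriv (fun s => φ s x) t

theorem IsSpaceTimeTest.hasFDerivAt (hφ : IsSpaceTimeTest Ω T φ) (z : ℝ × E3) :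
    HasFDerivAt (Function.uncurry φ) (fderiv ℝ (Function.uncurry φ) z) z :=
  (hφ.1.differentiable (by simp)).differentiableAt.hasFDerivAt

theorem IsSpaceTimeTest.hasDerivAt (hφ : IsSpaceTimeTest Ω T φ) (t : ℝ) (x : E3) :
    HasDerivAt (fun s => φ s x) (fderiv ℝ (Function.uncurry φ) (t, x) (1, 0)) t :=
  HasFDerivAt.comp_hasDerivAt (f := fun s => (s, x)) t (hφ.hasFDerivAt (t, x))
    ((hasDerivAt_id t).prodMk (hasDerivAt_const t x))

theorem IsSpaceTimeTest.timeDeriv_eq (hφ : IsSpaceTimeTest Ω T φ) (t : ℝ) (x : E3) :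
    timeDeriv φ t x = fderiv ℝ (Function.uncurry φ) (t, x) (1, 0) :=
  (hφ.hasDerivAt t x).deriv

theorem IsSpaceTimeTest.hasDerivAt_timeDeriv (hφ : IsSpaceTimeTest Ω T φ) (t : ℝ) (x : E3) :
    HasDerivAt (fun s => φ s x) (timeDeriv φ t x) t :=
  hφ.timeDeriv_eq t x ▸ hφ.hasDerivAt t x

theorem IsSpaceTimeTest.hasFDerivAt_slice (hφ : IsSpaceTimeTest Ω T φ) (t : ℝ) (x : E3) :
    HasFDerivAt (φ t) ((fderiv ℝ (Function.uncurry φ) (t, x)).comp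
      (ContinuousLinearMap.inr ℝ ℝ E3)) x :=
  (hφ.hasFDerivAt (t, x)).comp x ((hasFDerivAt_const t x).prodMk (hasFDerivAt_id x))

/-- Written through the space-time derivative, the spatial gradient is visibly continuous in `(t,
x)` jointly and zero off the space-time support. -/
theorem IsSpaceTimeTest.grad_eq (hφ : IsSpaceTimeTest Ω T φ) (t : ℝ) (x : E3) :
    grad (φ t) x = Matrix.of fun i j =>
      (fderiv ℝ (Function.uncurry φ) (t, x) (0, EuclideanSpace.single j 1)) i := by
  ext i j
  simp [grad, (hφ.hasFDerivAt_slice t x).fderiv]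

theorem IsSpaceTimeTest.continuous_fderiv (hφ : IsSpaceTimeTest Ω T φ) :
    Continuous (fderiv ℝ (Function.uncurry φ)) := hφ.1.continuous_fderiv (by simp)

theorem IsSpaceTimeTest.fderiv_eq_zero (_hφ : IsSpaceTimeTest Ω T φ) {z : ℝ × E3}
    (hz : z ∉ tsupport (Function.uncurry φ)) : fderiv ℝ (Function.uncurry φ) z = 0 :=
  image_eq_zero_of_notMem_tsupport fun h => hz (tsupport_fderiv_subset ℝ h)

theorem IsSpaceTimeTest.continuous_timeDeriv (hφ : IsSpaceTimeTest Ω T φ) :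
    Continuous (Function.uncurry (timeDeriv φ)) := by
  have : Function.uncurry (timeDeriv φ) = fun z => fderiv ℝ (Function.uncurry φ) z (1, 0) :=
    funext fun z => hφ.timeDeriv_eq z.1 z.2
  rw [this]
  exact hφ.continuous_fderiv.clm_apply continuous_const

theorem IsSpaceTimeTest.hasCompactSupport_timeDeriv (hφ : IsSpaceTimeTest Ω T φ) :
    HasCompactSupport (Function.uncurry (timeDeriv φ)) :=
  HasCompactSupport.intro hφ.2.1 fun z hz => by
    rw [Function.uncurry, hφ.timeDeriv_eq, hφ.fderiv_eq_zero hz]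
    rfl

theorem IsSpaceTimeTest.continuous_grad (hφ : IsSpaceTimeTest Ω T φ) :
    Continuous fun z : ℝ × E3 => grad (φ z.1) z.2 := by
  have : (fun z : ℝ × E3 => grad (φ z.1) z.2) = fun z => Matrix.of fun i j =>
      (fderiv ℝ (Function.uncurry φ) z (0, EuclideanSpace.single j 1)) i :=
    funext fun z => hφ.grad_eq z.1 z.2
  rw [this]
  refine continuous_matrix fun i j => ?_
  have := hφ.continuous_fderiv.clm_apply
    (continuous_const (y := ((0 : ℝ), (EuclideanSpace.single j 1 : E3))))
  exact (EuclideanSpace.proj (𝕜 := ℝ) i).continuous.comp this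

theorem IsSpaceTimeTest.grad_eq_zero (hφ : IsSpaceTimeTest Ω T φ) {z : ℝ × E3}
    (hz : z ∉ tsupport (Function.uncurry φ)) : grad (φ z.1) z.2 = 0 := by
  rw [hφ.grad_eq, hφ.fderiv_eq_zero hz]
  rfl

theorem IsSpaceTimeTest.exists_abs_grad_le (hφ : IsSpaceTimeTest Ω T φ) :
    ∃ C, ∀ t x i j, |grad (φ t) x i j| ≤ C := by
  have hb : ∀ i j, ∃ C, ∀ z : ℝ × E3, ‖grad (φ z.1) z.2 i j‖ ≤ C := fun i j => by
    refine HasCompactSupport.exists_bound_of_continuous ?_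
      ((continuous_entry i j).comp hφ.continuous_grad)
    exact HasCompactSupport.intro hφ.2.1 fun z hz => by simp [hφ.grad_eq_zero hz]
  choose C hC using hb
  refine ⟨∑ i, ∑ j, |C i j|, fun t x i j => (hC i j (t, x)).trans ((le_abs_self _).trans ?_)⟩
  refine (Finset.single_le_sum (f := fun j => |C i j|) (fun _ _ => abs_nonneg _)
    (Finset.mem_univ j)).trans ?_
  exact Finset.single_le_sum (f := fun i => ∑ j, |C i j|)
    (fun _ _ => Finset.sum_nonneg fun _ _ => abs_nonneg _) (Finset.mem_univ i)

theorem IsSpaceTimeTest.isTest (hφ : IsSpaceTimeTest Ω T φ) (t : ℝ) : IsTest Ω (φ t) := by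
  have hK : IsCompact (Prod.snd '' tsupport (Function.uncurry φ)) :=
    hφ.2.1.isCompact.image continuous_snd
  have hsub : tsupport (φ t) ⊆ Prod.snd '' tsupport (Function.uncurry φ) :=
    closure_minimal (fun x hx => ⟨(t, x), subset_tsupport _ hx, rfl⟩) hK.isClosed
  refine ⟨hφ.1.comp (contDiff_const.prodMk contDiff_id), hK.of_isClosed_subset
    (isClosed_tsupport _) hsub, hsub.trans ?_⟩
  rintro _ ⟨z, hz, rfl⟩
  exact (hφ.2.2 hz).2

theorem IsSpaceTimeTest.eq_zero_of_notMem (hφ : IsSpaceTimeTest Ω T φ) {t : ℝ}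
    (ht : t ∉ Ioo 0 T) (x : E3) : (t, x) ∉ tsupport (Function.uncurry φ) :=
  fun h => ht (hφ.2.2 h).1

theorem isSpaceTimeTest_zero : IsSpaceTimeTest Ω T 0 := by
  have : Function.uncurry (0 : ℝ → E3 → E3) = 0 := rfl
  refine ⟨this ▸ contDiff_const, this ▸ HasCompactSupport.zero, ?_⟩
  rw [this, tsupport_zero]
  exact empty_subset _

theorem IsSpaceTimeTest.add {ψ : ℝ → E3 → E3} (hφ : IsSpaceTimeTest Ω T φ)
    (hψ : IsSpaceTimeTest Ω T ψ) : IsSpaceTimeTest Ω T (φ + ψ) := by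
  have : Function.uncurry (φ + ψ) = Function.uncurry φ + Function.uncurry ψ := rfl
  refine ⟨this ▸ hφ.1.add hψ.1, this ▸ hφ.2.1.add hψ.2.1, ?_⟩
  rw [this]
  exact (tsupport_add _ _).trans (union_subset hφ.2.2 hψ.2.2)

theorem IsSpaceTimeTest.const_smul (hφ : IsSpaceTimeTest Ω T φ) (c : ℝ) :
    IsSpaceTimeTest Ω T (c • φ) := by
  have : Function.uncurry (c • φ) = fun z => c • Function.uncurry φ z := rfl
  have hsub : tsupport (Function.uncurry (c • φ)) ⊆ tsupport (Function.uncurry φ) := by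
    rw [this]
    exact closure_mono fun z hz h => hz (by simp [h])
  exact ⟨this ▸ hφ.1.const_smul c,
    hφ.2.1.isCompact.of_isClosed_subset (isClosed_tsupport _) hsub, hsub.trans hφ.2.2⟩

theorem IsSpaceTimeTest.grad_add {ψ : ℝ → E3 → E3} (hφ : IsSpaceTimeTest Ω T φ)
    (hψ : IsSpaceTimeTest Ω T ψ) (t : ℝ) (x : E3) :
    grad ((φ + ψ) t) x = grad (φ t) x + grad (ψ t) x := by
  ext i j
  have h := (hφ.hasFDerivAt_slice t x).add (hψ.hasFDerivAt_slice t x)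
  simp only [grad, Matrix.of_apply, Pi.add_apply, Matrix.add_apply]
  rw [h.fderiv, (hφ.hasFDerivAt_slice t x).fderiv,
    (hψ.hasFDerivAt_slice t x).fderiv]
  rfl

theorem IsSpaceTimeTest.grad_smul (hφ : IsSpaceTimeTest Ω T φ) (c : ℝ) (t : ℝ) (x : E3) :
    grad ((c • φ) t) x = c • grad (φ t) x := by
  ext i j
  have h := (hφ.hasFDerivAt_slice t x).const_smul c
  simp only [grad, Matrix.of_apply, Matrix.smul_apply]
  rw [show (c • φ) t = c • φ t from rfl, h.fderiv, (hφ.hasFDerivAt_slice t x).fderiv]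
  rfl

theorem IsSpaceTimeTest.timeDeriv_add {ψ : ℝ → E3 → E3} (hφ : IsSpaceTimeTest Ω T φ)
    (hψ : IsSpaceTimeTest Ω T ψ) (t : ℝ) (x : E3) :
    timeDeriv (φ + ψ) t x = timeDeriv φ t x + timeDeriv ψ t x :=
  ((hφ.hasDerivAt_timeDeriv t x).add (hψ.hasDerivAt_timeDeriv t x)).deriv

theorem IsSpaceTimeTest.timeDeriv_smul (hφ : IsSpaceTimeTest Ω T φ) (c : ℝ) (t : ℝ) (x : E3) :
    timeDeriv (c • φ) t x = c • timeDeriv φ t x :=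
  ((hφ.hasDerivAt_timeDeriv t x).const_smul c).deriv

variable (Ω T) in
/-- The divergence-free fields in `C_c^∞(Ω × (0,T); ℝ³)`. -/
def solenoidalTests : Submodule ℝ (ℝ → E3 → E3) where
  carrier := {φ | IsSpaceTimeTest Ω T φ ∧ ∀ t x, (grad (φ t) x).trace = 0}
  zero_mem' := ⟨isSpaceTimeTest_zero, fun t x => by
    have : grad ((0 : ℝ → E3 → E3) t) x = 0 := by
      ext i j
      simp [grad]
    rw [this, Matrix.trace_zero]⟩
  add_mem' hφ hψ := ⟨hφ.1.add hψ.1, fun t x => by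
    rw [hφ.1.grad_add hψ.1, Matrix.trace_add, hφ.2, hψ.2, add_zero]⟩
  smul_mem' c φ hφ := ⟨hφ.1.const_smul c, fun t x => by
    rw [hφ.1.grad_smul, Matrix.trace_smul, hφ.2, smul_zero]⟩

end

/-! ### Test fields in the energy-variational inequality -/

section

open scoped CompactlySupported

variable {Ω : Set E3} {T : ℝ} {φ : ℝ → E3 → E3}

theorem isFiniteMeasure_vol (hΩ : Bornology.IsBounded Ω) : IsFiniteMeasure (vol Ω) :=
  ⟨by simpa using hΩ.measure_lt_top⟩

theorem isBoundedLinearMap_of_contraction {A B : Type*} [NormedAddCommGroup A] [NormedSpace ℝ A]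
    [NormedAddCommGroup B] [NormedSpace ℝ B] {J : A → B} (hadd : ∀ a b, J (a + b) = J a + J b)
    (hsmul : ∀ (r : ℝ) a, J (r • a) = r • J a) (hJ : ∀ a, ‖J a‖ ≤ ‖a‖) : IsBoundedLinearMap ℝ J :=
  IsLinearMap.with_bound ⟨hadd, hsmul⟩ 1 (by simpa using hJ)

theorem derivWithin_of_contraction {A B : Type*} [NormedAddCommGroup A] [NormedSpace ℝ A]
    [NormedAddCommGroup B] [NormedSpace ℝ B] {J : A → B} (hadd : ∀ a b, J (a + b) = J a + J b)
    (hsmul : ∀ (r : ℝ) a, J (r • a) = r • J a) (hJ : ∀ a, ‖J a‖ ≤ ‖a‖) {c : ℝ → A} {c' : A} {t : ℝ}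
    {s : Set ℝ} (h : HasDerivAt c c' t) (hs : UniqueDiffWithinAt ℝ s t) :
    derivWithin (fun r => J (c r)) s t = J c' :=
  ((isBoundedLinearMap_of_contraction hadd hsmul hJ).hasFDerivAt.comp_hasDerivAt t
    h).hasDerivWithinAt.derivWithin hs

theorem contDiff_of_contraction {A B : Type*} [NormedAddCommGroup A] [NormedSpace ℝ A]
    [NormedAddCommGroup B] [NormedSpace ℝ B] {J : A → B} (hadd : ∀ a b, J (a + b) = J a + J b)
    (hsmul : ∀ (r : ℝ) a, J (r • a) = r • J a) (hJ : ∀ a, ‖J a‖ ≤ ‖a‖) : ContDiff ℝ 1 J :=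
  (isBoundedLinearMap_of_contraction hadd hsmul hJ).contDiff

variable (Ω) in
/-- The embedding of `L²` in the dual space of `H¹_{0,σ}`. -/
def dualEmbedding (w : Lp E3 2 (vol Ω)) : H10sigma Ω →L[ℝ] ℝ :=
  (innerSL ℝ w).comp ((ContinuousLinearMap.fst ℝ _ _).comp (H10sigma Ω).subtypeL)

theorem norm_dualEmbedding_le (w : Lp E3 2 (vol Ω)) : ‖dualEmbedding Ω w‖ ≤ ‖w‖ := by
  refine ContinuousLinearMap.opNorm_le_bound _ (norm_nonneg w) fun p => ?_
  have h1 : ‖dualEmbedding Ω w p‖ ≤ ‖w‖ * ‖(p : H1Pair Ω).1‖ :=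
    abs_real_inner_le_norm w (p : H1Pair Ω).1
  exact h1.trans (mul_le_mul_of_nonneg_left (norm_fst_le (p : H1Pair Ω)) (norm_nonneg w))

theorem contDiff_dualEmbedding : ContDiff ℝ 1 (dualEmbedding Ω) := by
  apply contDiff_of_contraction (J := dualEmbedding Ω)
  · intro a b
    simp [dualEmbedding]
  · intro r a
    simp [dualEmbedding]
  · exact norm_dualEmbedding_le

theorem derivWithin_dualEmbedding {c : ℝ → Lp E3 2 (vol Ω)} {c' : Lp E3 2 (vol Ω)} {t : ℝ}
    {s : Set ℝ} (h : HasDerivAt c c' t) (hs : UniqueDiffWithinAt ℝ s t) :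
    derivWithin (fun r => dualEmbedding Ω (c r)) s t = dualEmbedding Ω c' := by
  apply derivWithin_of_contraction (J := dualEmbedding Ω) (c := c) (c' := c') (t := t)
  · exact h
  · exact hs
  · intro a b
    simp [dualEmbedding]
  · intro r a
    simp [dualEmbedding]
  · exact norm_dualEmbedding_le

theorem dualEmbedding_apply (w : Lp E3 2 (vol Ω)) (p : H10sigma Ω) :
    dualEmbedding Ω w p = ∫ x in Ω, inner ℝ (w x) ((p : H1Pair Ω).1 x) :=
  L2.inner_def w (p : H1Pair Ω).1

theorem grad_neg_apply (hφ : IsSpaceTimeTest Ω T φ) (t : ℝ) (x : E3) :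
    grad ((-φ) t) x = -grad (φ t) x := by
  rw [← neg_one_smul ℝ φ, hφ.grad_smul, neg_one_smul]

theorem MemLp.entry_grad [IsFiniteMeasure (vol Ω)] (hφ : IsSpaceTimeTest Ω T φ) (t : ℝ) (i j : Fin 3) :
    MemLp (fun x => grad (φ t) x i j) 2 (vol Ω) := by
  obtain ⟨C, hC⟩ := hφ.exists_abs_grad_le
  have hc : Continuous fun x : E3 => grad (φ t) x i j :=
    ((continuous_entry i j).comp hφ.continuous_grad).comp (by fun_prop : Continuous fun x : E3 => (t, x))
  exact MemLp.of_bound hc.aestronglyMeasurable C (Eventually.of_forall fun x => hC t x i j)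

theorem memH10sigma_of_mem (hΩ : Bornology.IsBounded Ω) (hφ : φ ∈ solenoidalTests Ω T) (t : ℝ) :
    MemH10sigma Ω (φ t) (grad (φ t)) := by
  have := isFiniteMeasure_vol hΩ
  have h1 : MemLp (φ t) 2 (vol Ω) := memLp_slice hφ.1.1.continuous hφ.1.2.1 t
  have h2 := MemLp.entry_grad hφ.1 t
  have hr : Represents Ω (h1.toLp, fun i j => (h2 i j).toLp) (φ t) (grad (φ t)) :=
    ⟨h1.coeFn_toLp, fun i j => (h2 i j).coeFn_toLp⟩
  exact ⟨_, Submodule.le_topologicalClosure _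
    (Submodule.subset_span ⟨φ t, ⟨hφ.1.isTest t, hφ.2 t⟩, hr⟩), hr⟩

theorem memL2sigma_of_mem (hΩ : Bornology.IsBounded Ω) (hφ : φ ∈ solenoidalTests Ω T) (t : ℝ) :
    MemL2sigma Ω (φ t) := by
  have := isFiniteMeasure_vol hΩ
  have h1 : MemLp (φ t) 2 (vol Ω) := memLp_slice hφ.1.1.continuous hφ.1.2.1 t
  exact ⟨h1.toLp, Submodule.le_topologicalClosure _
    (Submodule.subset_span ⟨φ t, ⟨hφ.1.isTest t, hφ.2 t⟩, h1.coeFn_toLp⟩), h1.coeFn_toLp⟩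

theorem symNegPart_zero : symNegPart 0 = 0 := by
  rw [symNegPart_eq_cfc]
  have : symPart 0 = 0 := by simp [symPart]
  rw [this]
  simp [cfc_apply_zero]

/-- The weight is twice the norm of a curve in `L^∞` that comes from a continuous, compactly
supported function of `(t, x)`. -/
theorem continuous_weight (hΩ : Bornology.IsBounded Ω) (hφ : IsSpaceTimeTest Ω T φ) :
    Continuous fun t => weight Ω (grad (φ t)) := by
  have := isFiniteMeasure_vol hΩ
  have hc : Continuous (Function.uncurry fun t x => matSpectralNorm (symNegPart (grad (φ t) x))) :=
    continuous_matSpectralNorm.comp (continuous_symNegPart.comp hφ.continuous_grad)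
  have hs : HasCompactSupport
      (Function.uncurry fun t x => matSpectralNorm (symNegPart (grad (φ t) x))) :=
    HasCompactSupport.intro hφ.2.1 fun z hz => by
      simp [Function.uncurry, hφ.grad_eq_zero hz, symNegPart_zero, matSpectralNorm]
  have : Fact ((1 : ℝ≥0∞) ≤ ⊤) := ⟨le_top⟩
  have h := (continuous_toLpCurve (p := ⊤) (μ := vol Ω) hc hs).norm.const_mul 2
  simp only [toLpCurve, Lp.norm_toLp] at h
  exact h

/-- The curve in the dual space is the image of a `C¹` curve in `L²` under the bounded linear map
`dualEmbedding Ω`. -/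
theorem isAdmissibleTest_of_mem (hΩ : Bornology.IsBounded Ω) [IsFiniteMeasure (vol Ω)]
    (hφ : φ ∈ solenoidalTests Ω T) :
    IsAdmissibleTest Ω T φ (fun t => grad (φ t))
      (fun t => dualEmbedding Ω (toLpCurve 2 (vol Ω) hφ.1.1.continuous hφ.1.2.1 t)) where
  mem := by
    obtain ⟨C, hC⟩ := hφ.1.2.1.exists_bound_of_continuous hφ.1.1.continuous
    exact MemLp.of_bound hφ.1.1.continuous.aestronglyMeasurable C (Eventually.of_forall hC)
  grad_mem i j := by
    obtain ⟨C, hC⟩ := hφ.1.exists_abs_grad_le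
    exact MemLp.of_bound ((continuous_entry i j).comp hφ.1.continuous_grad).aestronglyMeasurable C
      (Eventually.of_forall fun z => hC z.1 z.2 i j)
  mem_H1 := Eventually.of_forall fun t => memH10sigma_of_mem hΩ hφ t
  mem_L2sigma t _ := memL2sigma_of_mem hΩ hφ t
  dual_eq t _ p := by
    rw [dualEmbedding_apply]
    refine integral_congr_ae ?_
    filter_upwards [coeFn_toLpCurve (p := 2) (μ := vol Ω) hφ.1.1.continuous hφ.1.2.1 t] with x hx
    rw [hx]
  dual_C1 := by
    have h2 := contDiff_toLpCurve (p := 2) (μ := vol Ω) hφ.1.1.continuous hφ.1.2.1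
      hφ.1.continuous_timeDeriv hφ.1.hasCompactSupport_timeDeriv hφ.1.hasDerivAt_timeDeriv
    have h3 : ContDiff ℝ 1 fun t =>
        dualEmbedding Ω (toLpCurve 2 (vol Ω) hφ.1.1.continuous hφ.1.2.1 t) :=
      ContDiff.comp (g := dualEmbedding Ω) contDiff_dualEmbedding h2
    exact h3.contDiffOn
  weight_cont := Eventually.of_forall fun t => ⟨fun x => symNegPart (grad (φ t) x),
    (continuous_symNegPart.comp (hφ.1.continuous_grad.comp
      (by fun_prop : Continuous fun x : E3 => (t, x)))).continuousOn, ae_eq_rfl⟩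
  weight_int := ((continuous_weight hΩ hφ.1).integrableOn_Icc (a := 0) (b := T)).mono_set
    Ioo_subset_Icc_self

theorem derivWithin_dualEmbedding_apply [IsFiniteMeasure (vol Ω)] (hφ : φ ∈ solenoidalTests Ω T) {τ : ℝ}
    (hτ : τ ∈ Ioo 0 T) {w : E3 → E3} {G : E3 → Mat3} (hw : MemH10sigma Ω w G) :
    derivWithin (fun t => dualEmbedding Ω (toLpCurve 2 (vol Ω) hφ.1.1.continuous hφ.1.2.1 t))
      (Icc 0 T) τ (toH10sigma Ω w G) = ∫ x in Ω, inner ℝ (w x) (timeDeriv φ τ x) := by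
  have hd : derivWithin
      (fun t => dualEmbedding Ω (toLpCurve 2 (vol Ω) hφ.1.1.continuous hφ.1.2.1 t)) (Icc 0 T) τ
      = dualEmbedding Ω (toLpCurve 2 (vol Ω) hφ.1.continuous_timeDeriv
        hφ.1.hasCompactSupport_timeDeriv τ) := by
    apply derivWithin_dualEmbedding
    · exact hasDerivAt_toLpCurve hφ.1.1.continuous hφ.1.2.1 hφ.1.continuous_timeDeriv
        hφ.1.hasCompactSupport_timeDeriv hφ.1.hasDerivAt_timeDeriv τ
    · exact uniqueDiffOn_Icc (hτ.1.trans hτ.2) τ (Ioo_subset_Icc_self hτ)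
  rw [hd, dualEmbedding_apply]
  refine integral_congr_ae ?_
  -- The assumption `hw` rules out the default value `0` of `toH10sigma`.
  have hw1 : ((toH10sigma Ω w G : H10sigma Ω) : H1Pair Ω).1 =ᵐ[vol Ω] w := by
    rw [toH10sigma, dif_pos hw]
    exact hw.choose_spec.2.1
  filter_upwards [hw1, coeFn_toLpCurve (p := 2) (μ := vol Ω) hφ.1.continuous_timeDeriv
    hφ.1.hasCompactSupport_timeDeriv τ] with x h3 h4
  rw [h3, h4, real_inner_comm]

/-! ### The fibre space `Ω̄ × 𝕊²` and the quadratic form of the gradient on it -/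

/-- Points of `Ω̄` with directions. -/
abbrev Directions (Ω : Set E3) := ↥(closure Ω) × ↥(Metric.sphere (0 : E3) 1)

theorem compactSpace_directions (hΩ : Bornology.IsBounded Ω) : CompactSpace (Directions Ω) := by
  have : CompactSpace ↥(closure Ω) := isCompact_iff_compactSpace.1 hΩ.isCompact_closure
  have : CompactSpace ↥(Metric.sphere (0 : E3) 1) :=
    isCompact_iff_compactSpace.1 (isCompact_sphere _ _)
  infer_instance

/-- Needed, with nonemptiness, for the existence of the conditional kernel. -/
theorem standardBorelSpace_directions : StandardBorelSpace (Directions Ω) := by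
  have : PolishSpace ↥(closure Ω) := isClosed_closure.polishSpace
  have : PolishSpace ↥(Metric.sphere (0 : E3) 1) := Metric.isClosed_sphere.polishSpace
  infer_instance

theorem nonempty_directions (hΩ : Ω.Nonempty) : Nonempty (Directions Ω) := by
  have : Nonempty ↥(closure Ω) := hΩ.closure.to_subtype
  have : Nonempty ↥(Metric.sphere (0 : E3) 1) := (NormedSpace.sphere_nonempty.2 zero_le_one).to_subtype
  infer_instance

theorem continuous_frob {X : Type*} [TopologicalSpace X] {A B : X → Mat3} (hA : Continuous A)
    (hB : Continuous B) : Continuous fun x => frob (A x) (B x) := by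
  unfold frob
  fun_prop

theorem continuous_outer_self : Continuous fun ξ : E3 => outer ξ ξ := by
  unfold outer
  refine continuous_matrix fun i j => ?_
  simp only [Matrix.of_apply]
  fun_prop

/-- The quadratic form `(t, x, ξ) ↦ ξ · ∇φ(t, x) ξ`. -/
def gradForm (Ω : Set E3) (T : ℝ) (hΩ : Bornology.IsBounded Ω) :
    solenoidalTests Ω T →ₗ[ℝ] C_c(ℝ × Directions Ω, ℝ) where
  toFun φ :=
    { toFun := fun z => frob (grad (φ.1 z.1) z.2.1) (outer z.2.2 z.2.2)
      continuous_toFun := continuous_frob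
        (φ.2.1.continuous_grad.comp (by fun_prop : Continuous fun z : ℝ × Directions Ω =>
          (z.1, (z.2.1 : E3))))
        (continuous_outer_self.comp (by fun_prop : Continuous fun z : ℝ × Directions Ω =>
          (z.2.2 : E3)))
      hasCompactSupport' := by
        have : CompactSpace (Directions Ω) := compactSpace_directions hΩ
        refine HasCompactSupport.intro ((φ.2.1.2.1.isCompact.image continuous_fst).prod
          isCompact_univ) fun z hz => ?_
        have hz' : (z.1, (z.2.1 : E3)) ∉ tsupport (Function.uncurry φ.1) := fun h =>
          hz ⟨⟨_, h, rfl⟩, mem_univ _⟩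
        have := φ.2.1.grad_eq_zero hz'
        simp only at this
        simp [this, frob] }
  map_add' φ ψ := by
    ext z
    change frob (grad ((φ.1 + ψ.1) z.1) z.2.1) _ = frob _ _ + frob _ _
    rw [φ.2.1.grad_add ψ.2.1]
    simp only [frob, Matrix.add_apply, add_mul, Finset.sum_add_distrib]
  map_smul' c φ := by
    ext z
    change frob (grad ((c • φ.1) z.1) z.2.1) _ = c • frob _ _
    rw [φ.2.1.grad_smul]
    simp only [frob, Matrix.smul_apply, smul_eq_mul, Finset.mul_sum, mul_assoc]

theorem gradForm_apply (hΩ : Bornology.IsBounded Ω) (φ : solenoidalTests Ω T) (z : ℝ × Directions Ω) :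
    gradForm Ω T hΩ φ z = frob (grad (φ.1 z.1) z.2.1) (outer z.2.2 z.2.2) := rfl

/-- The sign is the point: the negative part of `-(∇φ)_sym` is measured by the positive part of `ξ ·
∇φ ξ`. The essential supremum over `Ω` is at most the maximum over `Ω̄`. -/
theorem weight_neg_le (hΩ : Bornology.IsBounded Ω) [CompactSpace (Directions Ω)]
    (φ : solenoidalTests Ω T) (t : ℝ) :
    weight Ω (grad ((-φ.1) t)) ≤ 2 * posSup (slice (gradForm Ω T hΩ φ) t) := by
  rw [weight]
  refine mul_le_mul_of_nonneg_left ?_ zero_le_two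
  refine ENNReal.toReal_le_of_le_ofReal (posSup_nonneg _) ?_
  rw [eLpNorm_exponent_top]
  refine eLpNormEssSup_le_of_ae_bound ?_
  filter_upwards [ae_restrict_of_ae_restrict_of_subset subset_closure
    (ae_restrict_mem isClosed_closure.measurableSet)] with x hx
  rw [Real.norm_eq_abs, abs_of_nonneg (matSpectralNorm_nonneg _), grad_neg_apply φ.2.1]
  refine matSpectralNorm_symNegPart_neg_le _ (posSup_nonneg _) fun ξ hξ => ?_
  exact le_posSup (slice (gradForm Ω T hΩ φ) t) (⟨x, hx⟩, ⟨ξ, by simpa using hξ⟩)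

end

/-! ### Integration by parts in the convective term -/

section

variable {Ω : Set E3}

/-- By Hölder this is the inner product of one factor with `ψ` times the other. It allows the
convective identity to pass to the limit in `H¹`. -/
theorem continuous_integral_mul_mul {μ : Measure E3} {ψ : E3 → ℝ} (hψ : MemLp ψ ⊤ μ) :
    Continuous fun p : Lp ℝ 2 μ × Lp ℝ 2 μ => ∫ x, p.1 x * p.2 x * ψ x ∂μ := by
  have : Fact ((1 : ℝ≥0∞) ≤ ⊤) := ⟨le_top⟩
  let m := (ContinuousLinearMap.mul ℝ ℝ).holderL μ ⊤ 2 2 hψ.toLp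
  have h : (fun p : Lp ℝ 2 μ × Lp ℝ 2 μ => ∫ x, p.1 x * p.2 x * ψ x ∂μ)
      = fun p => inner ℝ p.1 (m p.2) := by
    ext p
    rw [L2.inner_def]
    refine integral_congr_ae ?_
    filter_upwards [(ContinuousLinearMap.mul ℝ ℝ).coeFn_holder (r := 2) hψ.toLp p.2,
      hψ.coeFn_toLp] with x h1 h2
    have h3 : m p.2 x = ψ x * p.2 x := h1.trans (by rw [h2]; rfl)
    rw [h3]
    simp only [RCLike.inner_apply, conj_trivial]
    ring
  rw [h]
  exact continuous_fst.inner (m.continuous.comp continuous_snd)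

variable (Ω) in
/-- The component `i` of the first entry of a pair. -/
def component (i : Fin 3) : H1Pair Ω → Lp ℝ 2 (vol Ω) := fun p =>
  (EuclideanSpace.proj (𝕜 := ℝ) i : E3 →L[ℝ] ℝ).compLpL 2 (vol Ω) p.1

theorem continuous_component (i : Fin 3) : Continuous (component Ω i) :=
  (ContinuousLinearMap.continuous _).comp continuous_fst

theorem coeFn_component (i : Fin 3) (p : H1Pair Ω) :
    component Ω i p =ᵐ[vol Ω] fun x => p.1 x i :=
  ContinuousLinearMap.coeFn_compLpL _ _

theorem isTest_entry_memLp_top {φ : E3 → E3} (hφ : IsTest Ω φ) (i : Fin 3) :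
    MemLp (fun x => φ x i) ⊤ (vol Ω) := by
  obtain ⟨C, hC⟩ := hφ.2.1.exists_bound_of_continuous hφ.1.continuous
  refine memLp_top_of_bound (by have := hφ.1.continuous; fun_prop) C (Eventually.of_forall fun x => ?_)
  exact (PiLp.norm_apply_le _ _).trans (hC x)

theorem IsTest.continuous_grad {φ : E3 → E3} (hφ : IsTest Ω φ) : Continuous (grad φ) := by
  have h := hφ.1.continuous_fderiv (by simp)
  unfold grad
  refine continuous_matrix fun i j => ?_
  exact (EuclideanSpace.proj (𝕜 := ℝ) i).continuous.comp (h.clm_apply continuous_const)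

theorem IsTest.grad_eq_zero {φ : E3 → E3} {x : E3} (hx : x ∉ tsupport φ) : grad φ x = 0 := by
  have : fderiv ℝ φ x = 0 := image_eq_zero_of_notMem_tsupport fun h => hx (tsupport_fderiv_subset ℝ h)
  ext i j
  simp [grad, this]

theorem IsTest.hasCompactSupport_grad_entry {φ : E3 → E3} (hφ : IsTest Ω φ) (i j : Fin 3) :
    HasCompactSupport fun x => grad φ x i j :=
  HasCompactSupport.intro hφ.2.1 fun x hx => by simp [IsTest.grad_eq_zero hx]

theorem IsTest.continuous_grad_entry {φ : E3 → E3} (hφ : IsTest Ω φ) (i j : Fin 3) :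
    Continuous fun x => grad φ x i j := (continuous_entry i j).comp hφ.continuous_grad

theorem isTest_grad_memLp_top {φ : E3 → E3} (hφ : IsTest Ω φ) (i j : Fin 3) :
    MemLp (fun x => grad φ x i j) ⊤ (vol Ω) := by
  obtain ⟨C, hC⟩ := (hφ.hasCompactSupport_grad_entry i j).exists_bound_of_continuous
    (hφ.continuous_grad_entry i j)
  exact memLp_top_of_bound (hφ.continuous_grad_entry i j).aestronglyMeasurable C
    (Eventually.of_forall hC)

theorem IsSolenoidalTest.hasFDerivAt {φ : E3 → E3} (hφ : IsSolenoidalTest Ω φ) (x : E3) :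
    HasFDerivAt φ (fderiv ℝ φ x) x := (hφ.1.1.differentiable (by simp)).differentiableAt.hasFDerivAt

theorem isSolenoidalTest_zero : IsSolenoidalTest Ω 0 := by
  refine ⟨⟨contDiff_const, HasCompactSupport.zero, by rw [tsupport_zero]; exact empty_subset _⟩, ?_⟩
  intro x
  simp [grad, Matrix.trace]

theorem grad_add_apply {φ ψ : E3 → E3} (hφ : IsSolenoidalTest Ω φ) (hψ : IsSolenoidalTest Ω ψ)
    (x : E3) : grad (φ + ψ) x = grad φ x + grad ψ x := by
  ext i j
  simp only [grad, Matrix.of_apply, Matrix.add_apply]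
  rw [((hφ.hasFDerivAt x).add (hψ.hasFDerivAt x)).fderiv]
  rfl

theorem grad_const_smul_apply {φ : E3 → E3} (hφ : IsSolenoidalTest Ω φ) (c : ℝ) (x : E3) :
    grad (c • φ) x = c • grad φ x := by
  ext i j
  simp only [grad, Matrix.of_apply, Matrix.smul_apply]
  rw [((hφ.hasFDerivAt x).const_smul c).fderiv]
  rfl

theorem IsSolenoidalTest.add {φ ψ : E3 → E3} (hφ : IsSolenoidalTest Ω φ)
    (hψ : IsSolenoidalTest Ω ψ) : IsSolenoidalTest Ω (φ + ψ) := by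
  refine ⟨⟨hφ.1.1.add hψ.1.1, hφ.1.2.1.add hψ.1.2.1,
    (tsupport_add _ _).trans (union_subset hφ.1.2.2 hψ.1.2.2)⟩, fun x => ?_⟩
  rw [grad_add_apply hφ hψ, Matrix.trace_add, hφ.2, hψ.2, add_zero]

theorem IsSolenoidalTest.const_smul {φ : E3 → E3} (hφ : IsSolenoidalTest Ω φ) (c : ℝ) :
    IsSolenoidalTest Ω (c • φ) := by
  have hsub : tsupport (c • φ) ⊆ tsupport φ := closure_mono fun z hz h => hz (by simp [h])
  refine ⟨⟨hφ.1.1.const_smul c, hφ.1.2.1.isCompact.of_isClosed_subset (isClosed_tsupport _) hsub,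
    hsub.trans hφ.1.2.2⟩, fun x => ?_⟩
  rw [grad_const_smul_apply hφ, Matrix.trace_smul, hφ.2, smul_zero]

/-- Solenoidal test fields already form a linear space, so the span adds nothing. This matters
because the convective identity is quadratic and would not extend from a set to its span by
linearity. -/
theorem exists_test_of_mem_span {p : H1Pair Ω}
    (hp : p ∈ Submodule.span ℝ {p | ∃ φ, IsSolenoidalTest Ω φ ∧ Represents Ω p φ (grad φ)}) :
    ∃ φ, IsSolenoidalTest Ω φ ∧ Represents Ω p φ (grad φ) := by
  induction hp using Submodule.span_induction with
  | mem p hp => exact hp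
  | zero =>
    refine ⟨0, isSolenoidalTest_zero, Lp.coeFn_zero _ _ _, fun i j => ?_⟩
    filter_upwards [Lp.coeFn_zero ℝ 2 (vol Ω)] with x hx
    simpa [grad] using hx
  | add p q _ _ hp hq =>
    obtain ⟨φ, hφ, hφ1, hφ2⟩ := hp
    obtain ⟨ψ, hψ, hψ1, hψ2⟩ := hq
    refine ⟨φ + ψ, hφ.add hψ, (Lp.coeFn_add _ _).trans (hφ1.add hψ1), fun i j => ?_⟩
    refine (Lp.coeFn_add (p.2 i j) (q.2 i j)).trans (((hφ2 i j).add (hψ2 i j)).trans ?_)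
    refine Eventually.of_forall fun x => ?_
    simp [grad_add_apply hφ hψ]
  | smul c p _ hp =>
    obtain ⟨φ, hφ, hφ1, hφ2⟩ := hp
    refine ⟨c • φ, hφ.const_smul c, (Lp.coeFn_smul _ _).trans (hφ1.const_smul c), fun i j => ?_⟩
    refine (Lp.coeFn_smul c (p.2 i j)).trans (((hφ2 i j).const_smul c).trans ?_)
    refine Eventually.of_forall fun x => ?_
    simp [grad_const_smul_apply hφ]

/-- Integration by parts of `w_i w_j` against `∂_j φ_i`. The compact support of `φ` in `Ω` allows
integration over the whole space without boundary terms, and the extra term `w_i ∂_j w_j` sums to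
zero over `j` because `w` has no divergence. -/
theorem integral_convective_test {w φ : E3 → E3} (hw : IsSolenoidalTest Ω w) (hφ : IsTest Ω φ) :
    ∑ i, ∑ j, ((∫ x in Ω, grad w x i j * w x j * φ x i)
      + ∫ x in Ω, w x i * w x j * grad φ x i j) = 0 := by
  have hwc : ∀ i, Continuous fun x => w x i := fun i => by
    have := hw.1.1.continuous
    fun_prop
  have hφc : ∀ i, Continuous fun x => φ x i := fun i => by
    have := hφ.1.continuous
    fun_prop
  have hφs : ∀ i, HasCompactSupport fun x => φ x i := fun i =>
    HasCompactSupport.intro hφ.2.1 fun x hx => by simp [image_eq_zero_of_notMem_tsupport hx]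
  have hwd : ∀ i x, HasFDerivAt (fun x => w x i)
      ((EuclideanSpace.proj (𝕜 := ℝ) i).comp (fderiv ℝ w x)) x := fun i x =>
    (EuclideanSpace.proj (𝕜 := ℝ) i).hasFDerivAt.comp x (hw.hasFDerivAt x)
  have hφd : ∀ i x, HasFDerivAt (fun x => φ x i)
      ((EuclideanSpace.proj (𝕜 := ℝ) i).comp (fderiv ℝ φ x)) x := fun i x =>
    (EuclideanSpace.proj (𝕜 := ℝ) i).hasFDerivAt.comp x
      (hφ.1.differentiable (by simp)).differentiableAt.hasFDerivAt
  have e1 : ∀ i j, (∫ x in Ω, grad w x i j * w x j * φ x i) = ∫ x, grad w x i j * w x j * φ x i :=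
    fun i j => setIntegral_eq_integral_of_forall_compl_eq_zero fun x hx => by
      rw [image_eq_zero_of_notMem_tsupport fun h => hx (hφ.2.2 h)]
      simp
  have e2 : ∀ i j, (∫ x in Ω, w x i * w x j * grad φ x i j) = ∫ x, w x i * w x j * grad φ x i j :=
    fun i j => setIntegral_eq_integral_of_forall_compl_eq_zero fun x hx => by
      rw [IsTest.grad_eq_zero fun h => hx (hφ.2.2 h)]
      simp
  have hint : ∀ i j k l, Integrable fun x => grad w x i j * w x k * φ x l := fun i j k l =>
    (((hw.1.continuous_grad_entry i j).mul (hwc k)).mul (hφc l)).integrable_of_hasCompactSupport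
      (hφs l).mul_left
  have e3 : ∀ i j, (∫ x, w x i * w x j * grad φ x i j)
      = -((∫ x, grad w x i j * w x j * φ x i) + ∫ x, grad w x j j * w x i * φ x i) := by
    intro i j
    have hd : ∀ x, HasFDerivAt (fun x => w x i * w x j) _ x := fun x => (hwd i x).mul (hwd j x)
    have hg : ∀ x, fderiv ℝ (fun x => w x i * w x j) x (EuclideanSpace.single j 1)
        = grad w x i j * w x j + grad w x j j * w x i := fun x => by
      rw [(hd x).fderiv]
      simp [grad]
      ring
    have hg' : ∀ x, fderiv ℝ (fun x => φ x i) x (EuclideanSpace.single j 1) = grad φ x i j := fun x => by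
      rw [(hφd i x).fderiv]
      simp [grad]
    have h := integral_mul_fderiv_eq_neg_fderiv_mul_of_integrable (μ := volume)
      (f := fun x => w x i * w x j) (g := fun x => φ x i) (v := EuclideanSpace.single j 1)
      (by
        simp only [hg, add_mul]
        exact (hint i j j i).add (hint j j i i))
      (by
        simp only [hg']
        exact (((hwc i).mul (hwc j)).mul (hφ.continuous_grad_entry i j)).integrable_of_hasCompactSupport
          (hφ.hasCompactSupport_grad_entry i j).mul_left)
      ((((hwc i).mul (hwc j)).mul (hφc i)).integrable_of_hasCompactSupport (hφs i).mul_left)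
      (fun x _ => (hd x).differentiableAt) (fun x _ => (hφd i x).differentiableAt)
    simp only [hg, hg'] at h
    rw [h, ← integral_add (hint i j j i) (hint j j i i)]
    simp only [add_mul]
  have e4 : ∀ i, ∑ j, (∫ x, grad w x j j * w x i * φ x i) = 0 := fun i => by
    rw [← integral_finsetSum _ fun j _ => hint j j i i]
    refine integral_eq_zero_of_ae (Eventually.of_forall fun x => ?_)
    have := hw.2 x
    simp only [Matrix.trace, Matrix.diag_apply] at this
    simp only [← Finset.sum_mul, this, zero_mul, Pi.zero_apply]
  refine Finset.sum_eq_zero fun i _ => ?_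
  simp only [e1, e2, e3, neg_add, add_neg_cancel_left]
  rw [Finset.sum_neg_distrib, e4, neg_zero]

/-- `∫ (v · ∇)v · φ = -∫ (v ⊗ v) : ∇φ` for solenoidal `v`. -/
theorem integral_convective {u : E3 → E3} {G : E3 → Mat3} (hu : MemH10sigma Ω u G) {φ : E3 → E3}
    (hφ : IsTest Ω φ) :
    ∫ x in Ω, inner ℝ (mv (G x) (u x)) (φ x) = -∫ x in Ω, frob (outer (u x) (u x)) (grad φ x) := by
  obtain ⟨p, hp, hp1, hp2⟩ := hu
  -- The defect in the identity, as a continuous function on `H¹` pairs; it vanishes on test fields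
  -- and hence on their closure.
  let Q : H1Pair Ω → ℝ := fun p => ∑ i, ∑ j,
    ((∫ x in Ω, p.2 i j x * component Ω j p x * φ x i)
      + ∫ x in Ω, component Ω i p x * component Ω j p x * grad φ x i j)
  have hQ : Continuous Q := by
    refine continuous_finsetSum _ fun i _ => continuous_finsetSum _ fun j _ => Continuous.add ?_ ?_
    · exact (continuous_integral_mul_mul (isTest_entry_memLp_top hφ i)).comp
        (((continuous_apply_apply i j).comp continuous_snd).prodMk (continuous_component j))
    · exact (continuous_integral_mul_mul (isTest_grad_memLp_top hφ i j)).comp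
        ((continuous_component i).prodMk (continuous_component j))
  have hQrep : ∀ (p : H1Pair Ω) (u : E3 → E3) (G : E3 → Mat3), Represents Ω p u G →
      Q p = ∑ i, ∑ j, ((∫ x in Ω, G x i j * u x j * φ x i)
        + ∫ x in Ω, u x i * u x j * grad φ x i j) := by
    intro p u G h
    refine Finset.sum_congr rfl fun i _ => Finset.sum_congr rfl fun j _ => ?_
    congr 1
    · refine integral_congr_ae ?_
      filter_upwards [h.1, h.2 i j, coeFn_component j p] with x h1 h2 h3
      rw [h2, h3, h1]
    · refine integral_congr_ae ?_
      filter_upwards [h.1, coeFn_component i p, coeFn_component j p] with x h1 h2 h3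
      rw [h2, h3, h1]
  have hQ0 : ∀ p ∈ H10sigma Ω, Q p = 0 := by
    intro p hp
    have hcl : IsClosed {p | Q p = 0} := isClosed_eq hQ continuous_const
    refine hcl.closure_subset_iff.2 ?_ hp
    intro q hq
    obtain ⟨w, hw, hwr⟩ := exists_test_of_mem_span hq
    exact (hQrep q w _ hwr).trans (integral_convective_test hw hφ)
  have key := hQ0 p hp
  rw [hQrep p u G ⟨hp1, hp2⟩] at key
  have hu2 : ∀ i, MemLp (fun x => u x i) 2 (vol Ω) := fun i =>
    (Lp.memLp (component Ω i p)).ae_eq ((coeFn_component i p).trans (by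
      filter_upwards [hp1] with x hx
      rw [hx]))
  have hG2 : ∀ i j, MemLp (fun x => G x i j) 2 (vol Ω) := fun i j => (Lp.memLp (p.2 i j)).ae_eq (hp2 i j)
  have i1 : ∀ i j, Integrable (fun x => G x i j * u x j * φ x i) (vol Ω) := fun i j =>
    memLp_one_iff_integrable.1 ((isTest_entry_memLp_top hφ i).mul'
      ((hu2 j).mul' (hG2 i j) : MemLp (fun x => G x i j * u x j) 1 (vol Ω)))
  have i2 : ∀ i j, Integrable (fun x => u x i * u x j * grad φ x i j) (vol Ω) := fun i j =>
    memLp_one_iff_integrable.1 ((isTest_grad_memLp_top hφ i j).mul'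
      ((hu2 j).mul' (hu2 i) : MemLp (fun x => u x i * u x j) 1 (vol Ω)))
  simp only [Finset.sum_add_distrib] at key
  rw [eq_neg_iff_add_eq_zero, ← key]
  congr 1
  · simp only [← integral_finsetSum _ fun j _ => i1 _ j]
    rw [← integral_finsetSum _ fun i _ => integrable_finsetSum _ fun j _ => i1 i j]
    refine integral_congr_ae (Eventually.of_forall fun x => ?_)
    simp only [mv, Matrix.mulVec, dotProduct, PiLp.inner_apply, RCLike.inner_apply, conj_trivial,
      Fin.sum_univ_three]
    ring
  · simp only [← integral_finsetSum _ fun j _ => i2 _ j]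
    rw [← integral_finsetSum _ fun i _ => integrable_finsetSum _ fun j _ => i2 i j]
    rfl

end

/-! ### Integrability of products of fields -/

section

variable {α : Type*} [MeasurableSpace α] {μ : Measure α} {A B G : α → Mat3} {a b d w : α → E3}

theorem memLp_finsetSum_fin {p : ℝ≥0∞} {f : Fin 3 → α → ℝ} (hf : ∀ i, MemLp (f i) p μ) :
    MemLp (fun z => ∑ i, f i z) p μ := memLp_finsetSum _ fun i _ => hf i

theorem memLp_two_mul_top {f g : α → ℝ} (hf : MemLp f ⊤ μ) (hg : MemLp g 2 μ) :
    MemLp (fun z => f z * g z) 2 μ := hg.mul' hf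

theorem memLp_two_top_mul {f g : α → ℝ} (hf : MemLp f 2 μ) (hg : MemLp g ⊤ μ) :
    MemLp (fun z => f z * g z) 2 μ := hg.mul' hf

theorem memLp_one_mul_top {f g : α → ℝ} (hf : Integrable f μ) (hg : MemLp g ⊤ μ) :
    Integrable (fun z => f z * g z) μ :=
  memLp_one_iff_integrable.1 (hg.mul' (memLp_one_iff_integrable.2 hf))

theorem memLp_symPart (hG : ∀ i j, MemLp (fun z => G z i j) 2 μ) (i j : Fin 3) :
    MemLp (fun z => symPart (G z) i j) 2 μ := by
  simpa [symPart] using ((hG i j).add (hG j i)).const_mul (1 / 2 : ℝ)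

theorem memLp_mv (hA : ∀ i j, MemLp (fun z => A z i j) 2 μ) (hb : ∀ i, MemLp (fun z => b z i) ⊤ μ)
    (i : Fin 3) : MemLp (fun z => mv (A z) (b z) i) 2 μ := by
  simp only [mv, Matrix.mulVec, dotProduct]
  exact memLp_finsetSum_fin fun j => memLp_two_top_mul (hA i j) (hb j)

theorem memLp_outer (ha : ∀ i, MemLp (fun z => a z i) ⊤ μ) (hb : ∀ i, MemLp (fun z => b z i) 2 μ)
    (i j : Fin 3) : MemLp (fun z => outer (a z) (b z) i j) 2 μ :=
  memLp_two_mul_top (ha i) (hb j)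

/-- `T^D` is linear in the velocity gradient with coefficients polynomial in `d`, which is bounded.
-/
theorem memLp_stressD (c : Coefficients) (hd : ∀ i, MemLp (fun z => d z i) ⊤ μ)
    (hG : ∀ i j, MemLp (fun z => G z i j) 2 μ) (i j : Fin 3) :
    MemLp (fun z => stressD c (d z) (G z) i j) 2 μ := by
  have hS := memLp_symPart hG
  have hSd := memLp_mv hS hd
  have h1 : MemLp (fun z => inner ℝ (d z) (mv (symPart (G z)) (d z))) 2 μ := by
    simp only [PiLp.inner_apply, RCLike.inner_apply, conj_trivial]
    exact memLp_finsetSum_fin fun k => memLp_two_top_mul (hSd k) (hd k)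
  have h2 := memLp_two_top_mul (memLp_two_top_mul (h1.const_mul (c.μ₁ + c.lam ^ 2)) (hd i)) (hd j)
  have h3 := (hS i j).const_mul c.μ₄
  have h4 := (memLp_symPart (memLp_outer hd hSd) i j).const_mul (c.μ₅ + c.μ₆ - c.lam ^ 2)
  convert (h2.add h3).add h4 using 1
  ext z
  simp [stressD, outer, mul_assoc]

theorem memLp_stressElastic (c : Coefficients) (hd : ∀ i, MemLp (fun z => d z i) ⊤ μ)
    (hw : ∀ i, MemLp (fun z => w z i) 2 μ) (i j : Fin 3) :
    MemLp (fun z => stressElastic c (d z) (w z) i j) 2 μ := by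
  have hp : ∀ i, MemLp (fun z => projLap (d z) (w z) i) 2 μ := fun i => by
    have h := fun a b => (memLp_two_mul_top (hd a) (hw b)).sub (memLp_two_mul_top (hd b) (hw a))
    fin_cases i
    · convert (h 1 2).neg using 1
      ext z
      simp [projLap, cross, crossProduct]
    · convert (h 2 0).neg using 1
      ext z
      simp [projLap, cross, crossProduct]
    · convert (h 0 1).neg using 1
      ext z
      simp [projLap, cross, crossProduct]
  have ho := memLp_outer hd hp
  convert ((memLp_symPart ho i j).const_mul c.lam).add
    (((ho i j).sub (ho j i)).const_mul (1 / 2 : ℝ)) using 1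
  ext z
  simp [stressElastic, skwPart]

theorem integrable_frob (hA : ∀ i j, MemLp (fun z => A z i j) 2 μ)
    (hB : ∀ i j, MemLp (fun z => B z i j) 2 μ) : Integrable (fun z => frob (A z) (B z)) μ :=
  integrable_finsetSum _ fun i _ => integrable_finsetSum _ fun j _ =>
    (hA i j).integrable_mul (hB i j)

theorem integrable_frob_top (hA : ∀ i j, Integrable (fun z => A z i j) μ)
    (hB : ∀ i j, MemLp (fun z => B z i j) ⊤ μ) : Integrable (fun z => frob (A z) (B z)) μ :=
  integrable_finsetSum _ fun i _ => integrable_finsetSum _ fun j _ =>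
    memLp_one_mul_top (hA i j) (hB i j)

theorem integrable_inner_top (ha : ∀ i, Integrable (fun z => a z i) μ)
    (hb : ∀ i, MemLp (fun z => b z i) ⊤ μ) : Integrable (fun z => inner ℝ (a z) (b z)) μ := by
  simp only [PiLp.inner_apply, RCLike.inner_apply, conj_trivial]
  refine integrable_finsetSum _ fun i _ => ?_
  simpa only [mul_comm] using memLp_one_mul_top (ha i) (hb i)

theorem integrable_transpose_mul_self (hA : ∀ i j, MemLp (fun z => A z i j) 2 μ) (i j : Fin 3) :
    Integrable (fun z => ((A z)ᵀ * A z) i j) μ := by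
  simp only [Matrix.mul_apply, Matrix.transpose_apply]
  exact integrable_finsetSum _ fun k _ => (hA k i).integrable_mul (hA k j)

theorem integrable_outer (ha : ∀ i, MemLp (fun z => a z i) 2 μ) (i j : Fin 3) :
    Integrable (fun z => outer (a z) (a z) i j) μ := (ha i).integrable_mul (ha j)

theorem integrable_mv (hA : ∀ i j, MemLp (fun z => A z i j) 2 μ) (ha : ∀ i, MemLp (fun z => a z i) 2 μ)
    (i : Fin 3) : Integrable (fun z => mv (A z) (a z) i) μ := by
  simp only [mv, Matrix.mulVec, dotProduct]
  exact integrable_finsetSum _ fun k _ => (hA i k).integrable_mul (ha k)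

theorem memLp_apply {p : ℝ≥0∞} (ha : MemLp a p μ) (i : Fin 3) : MemLp (fun z => a z i) p μ :=
  ha.of_le ((EuclideanSpace.proj (𝕜 := ℝ) i).continuous.comp_aestronglyMeasurable ha.1)
    (Eventually.of_forall fun _ => PiLp.norm_apply_le _ _)

end

/-! ### Bounds for the fields of a solution -/

section

variable {Ω : Set E3} {T : ℝ}

/-- Used with the energy bound, which controls `v t` and `gradD t` in `L²(Ω)` uniformly in time;
Tonelli gives the bound on the cylinder. -/
theorem memLp_cyl_of_integral_sq_le {H : Type*} [NormedAddCommGroup H] {g : ℝ → E3 → H} {C : ℝ}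
    (hg : AEStronglyMeasurable (Function.uncurry g) (cyl Ω T))
    (h2 : ∀ t ∈ Ioo 0 T, MemLp (g t) 2 (vol Ω)) (hC : ∀ t ∈ Ioo 0 T, ∫ x in Ω, ‖g t x‖ ^ 2 ≤ C) :
    MemLp (Function.uncurry g) 2 (cyl Ω T) := by
  refine ⟨hg, ?_⟩
  rw [eLpNorm_lt_top_iff_lintegral_rpow_enorm_lt_top two_ne_zero ENNReal.ofNat_ne_top]
  rw [lintegral_prod _ (hg.enorm.pow_const _)]
  have h : ∀ᵐ t ∂(volume.restrict (Ioo 0 T)),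
      ∫⁻ x in Ω, ‖Function.uncurry g (t, x)‖ₑ ^ (2 : ℝ≥0∞).toReal ≤ ENNReal.ofReal C := by
    filter_upwards [ae_restrict_mem measurableSet_Ioo] with t ht
    refine le_trans (le_of_eq ?_) (ENNReal.ofReal_le_ofReal (hC t ht))
    rw [ofReal_integral_eq_lintegral_ofReal ((memLp_two_iff_integrable_sq_norm (h2 t ht).1).1 (h2 t ht))
      (Eventually.of_forall fun x => sq_nonneg _)]
    refine lintegral_congr fun x => ?_
    simp [ENNReal.ofReal_pow]
  refine (lintegral_mono_ae h).trans_lt ?_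
  rw [lintegral_const]
  exact ENNReal.mul_lt_top ENNReal.ofReal_lt_top (measure_lt_top _ _)

theorem isH1With_congr {u u' : E3 → E3} (h : u =ᵐ[vol Ω] u') {G : E3 → Mat3} (hu : IsH1With Ω u G) :
    IsH1With Ω u' G := by
  refine ⟨hu.1.ae_eq h, hu.2.1, fun φ h1 h2 h3 i j => ?_⟩
  rw [← hu.2.2 φ h1 h2 h3 i j]
  refine integral_congr_ae ?_
  filter_upwards [h] with x hx
  rw [hx]

/-- The equality is literal: the predicates `IsH1With Ω u` and `IsH1With Ω u'` coincide, so the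
choice returns the same function. -/
theorem weakGrad_congr {u u' : E3 → E3} (h : u =ᵐ[vol Ω] u') : weakGrad Ω u = weakGrad Ω u' := by
  have : IsH1With Ω u = IsH1With Ω u' :=
    funext fun G => propext ⟨isH1With_congr h, isH1With_congr h.symm⟩
  unfold weakGrad
  rw [this]

theorem energy_congr {u u' δ δ' : E3 → E3} (hu : u =ᵐ[vol Ω] u') (hδ : δ =ᵐ[vol Ω] δ') :
    energy Ω u δ = energy Ω u' δ' := by
  rw [energy, energy, weakGrad_congr hδ]
  congr 2
  refine integral_congr_ae ?_
  filter_upwards [hu] with x hx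
  rw [hx]

/-- Fundamental lemma of the calculus of variations. It identifies the chosen gradient in the energy
with the field `gradD` of the equations. -/
theorem IsH1With.ae_eq (hΩo : IsOpen Ω) [IsFiniteMeasure (vol Ω)] {u : E3 → E3} {G G' : E3 → Mat3}
    (h : IsH1With Ω u G) (h' : IsH1With Ω u G') : G =ᵐ[vol Ω] G' := by
  have key : ∀ i j, ∀ᵐ x ∂vol Ω, G x i j = G' x i j := fun i j => by
    have hint : Integrable (fun x => G x i j - G' x i j) (vol Ω) :=
      ((h.2.1 i j).sub (h'.2.1 i j)).integrable one_le_two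
    have := hΩo.ae_eq_zero_of_integral_contDiff_smul_eq_zero (μ := volume)
      (f := fun x => G x i j - G' x i j) (IntegrableOn.locallyIntegrableOn hint) (fun g h1 h2 h3 => ?_)
    · filter_upwards [(ae_restrict_iff' hΩo.measurableSet).2 this] with x hx
      linarith
    · rw [← setIntegral_eq_integral_of_forall_compl_eq_zero (s := Ω) fun x hx => by
        rw [image_eq_zero_of_notMem_tsupport fun h => hx (h3 h), zero_smul]]
      obtain ⟨C, hC⟩ := h2.exists_bound_of_continuous h1.continuous
      have hg : MemLp g ⊤ (vol Ω) :=
        memLp_top_of_bound h1.continuous.aestronglyMeasurable C (Eventually.of_forall hC)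
      have e := (h.2.2 g h1 h2 h3 i j).symm.trans (h'.2.2 g h1 h2 h3 i j)
      have i1 := memLp_one_mul_top ((h.2.1 i j).integrable one_le_two) hg
      have i2 := memLp_one_mul_top ((h'.2.1 i j).integrable one_le_two) hg
      calc ∫ x in Ω, g x • (G x i j - G' x i j)
          = ∫ x in Ω, (G x i j * g x - G' x i j * g x) :=
            integral_congr_ae (Eventually.of_forall fun x => by simp only [smul_eq_mul]; ring)
        _ = 0 := by rw [integral_sub i1 i2]; linarith
  filter_upwards [ae_all_iff.2 fun i => ae_all_iff.2 (key i)] with x hx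
  ext i j
  exact hx i j

theorem IsH1With.weakGrad_ae_eq (hΩo : IsOpen Ω) [IsFiniteMeasure (vol Ω)] {u : E3 → E3} {G : E3 → Mat3}
    (h : IsH1With Ω u G) : weakGrad Ω u =ᵐ[vol Ω] G := by
  have h' : ∃ G, IsH1With Ω u G := ⟨G, h⟩
  rw [weakGrad, dif_pos h']
  exact h'.choose_spec.ae_eq hΩo h

theorem frob_self_nonneg (A : Mat3) : 0 ≤ frob A A :=
  Finset.sum_nonneg fun i _ => Finset.sum_nonneg fun j _ => mul_self_nonneg (A i j)

theorem sq_entry_le_frob_self (A : Mat3) (i j : Fin 3) : A i j ^ 2 ≤ frob A A := by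
  rw [sq]
  refine (Finset.single_le_sum (f := fun j => A i j * A i j) (fun _ _ => mul_self_nonneg _)
    (Finset.mem_univ j)).trans ?_
  exact Finset.single_le_sum (f := fun i => ∑ j, A i j * A i j)
    (fun _ _ => Finset.sum_nonneg fun _ _ => mul_self_nonneg _) (Finset.mem_univ i)

theorem energy_nonneg (u δ : E3 → E3) : 0 ≤ energy Ω u δ :=
  add_nonneg (mul_nonneg (by norm_num) (integral_nonneg fun _ => sq_nonneg _))
    (mul_nonneg (by norm_num) (integral_nonneg fun _ => frob_self_nonneg _))

theorem integral_norm_sq_le_energy (u δ : E3 → E3) : ∫ x in Ω, ‖u x‖ ^ 2 ≤ 2 * energy Ω u δ := by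
  have : 0 ≤ ∫ x in Ω, frob (weakGrad Ω δ x) (weakGrad Ω δ x) :=
    integral_nonneg fun _ => frob_self_nonneg _
  rw [energy]
  linarith

theorem energy_eq (hΩo : IsOpen Ω) [IsFiniteMeasure (vol Ω)] {u δ : E3 → E3} {G : E3 → Mat3}
    (h : IsH1With Ω δ G) :
    energy Ω u δ = 1 / 2 * (∫ x in Ω, ‖u x‖ ^ 2) + 1 / 2 * ∫ x in Ω, frob (G x) (G x) := by
  rw [energy]
  congr 2
  refine integral_congr_ae ?_
  filter_upwards [h.weakGrad_ae_eq hΩo] with x hx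
  rw [hx]

theorem integral_sq_entry_le_energy (hΩo : IsOpen Ω) [IsFiniteMeasure (vol Ω)] {u δ : E3 → E3}
    {G : E3 → Mat3} (h : IsH1With Ω δ G) (i j : Fin 3) :
    ∫ x in Ω, ‖G x i j‖ ^ 2 ≤ 2 * energy Ω u δ := by
  have h1 : ∫ x in Ω, ‖G x i j‖ ^ 2 ≤ ∫ x in Ω, frob (G x) (G x) := by
    refine integral_mono_of_nonneg (Eventually.of_forall fun x => sq_nonneg _)
      (integrable_frob h.2.1 h.2.1) (Eventually.of_forall fun x => ?_)
    simpa using sq_entry_le_frob_self (G x) i j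
  have h2 : 0 ≤ ∫ x in Ω, ‖u x‖ ^ 2 := integral_nonneg fun _ => sq_nonneg _
  rw [energy_eq hΩo h]
  linarith

theorem MemL2sigma.memLp {u : E3 → E3} (h : MemL2sigma Ω u) : MemLp u 2 (vol Ω) := by
  obtain ⟨p, _, hp⟩ := h
  exact (Lp.memLp p).ae_eq hp

end

section

variable {Ω : Set E3} {T : ℝ} {c : Coefficients} {v d : ℝ → E3 → E3}

theorem FlowFields.memLp_director (F : FlowFields Ω T c v d) [IsFiniteMeasure (vol Ω)] (i : Fin 3) :
    MemLp (fun z : ℝ × E3 => d z.1 z.2 i) ⊤ (cyl Ω T) := by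
  have h : MemLp (Function.uncurry d) ⊤ (cyl Ω T) := by
    refine memLp_top_of_bound F.d_meas 1 ?_
    -- The constraint is known slice by slice; going to almost every point of the cylinder needs a
    -- measurable set, hence the measurable representative.
    have h1 : ∀ᵐ z ∂cyl Ω T, ‖F.d_meas.mk _ z‖ ≤ 1 := by
      have hm : MeasurableSet {z | ‖F.d_meas.mk _ z‖ ≤ 1} :=
        F.d_meas.stronglyMeasurable_mk.norm.measurable measurableSet_Iic
      refine (Measure.ae_prod_mem_iff_ae_ae_mem hm).2 ?_
      filter_upwards [Measure.ae_ae_of_ae_prod F.d_meas.ae_eq_mk,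
        ae_restrict_mem measurableSet_Ioo] with t h1 ht
      filter_upwards [h1, F.d_unit t (Ioo_subset_Icc_self ht)] with x h2 h3
      rw [← h2]
      exact h3.le
    filter_upwards [h1, F.d_meas.ae_eq_mk] with z h2 h3
    rwa [h3]
  exact memLp_apply h i

theorem FlowFields.memLp_velocity (F : FlowFields Ω T c v d) [IsFiniteMeasure (vol Ω)] {C : ℝ}
    (hC : ∀ t ∈ Icc 0 T, energy Ω (v t) (d t) ≤ C) : MemLp (Function.uncurry v) 2 (cyl Ω T) :=
  memLp_cyl_of_integral_sq_le (C := 2 * C) F.v_meas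
    (fun t ht => (F.v_mem t (Ioo_subset_Icc_self ht)).memLp) fun t ht =>
      (integral_norm_sq_le_energy (v t) (d t)).trans
        (mul_le_mul_of_nonneg_left (hC t (Ioo_subset_Icc_self ht)) zero_le_two)

theorem FlowFields.memLp_gradD (F : FlowFields Ω T c v d) (hΩo : IsOpen Ω) [IsFiniteMeasure (vol Ω)]
    {C : ℝ} (hC : ∀ t ∈ Icc 0 T, energy Ω (v t) (d t) ≤ C) (i j : Fin 3) :
    MemLp (fun z : ℝ × E3 => F.gradD z.1 z.2 i j) 2 (cyl Ω T) :=
  memLp_cyl_of_integral_sq_le (C := 2 * C) (g := fun t x => F.gradD t x i j)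
    ((continuous_entry i j).comp_aestronglyMeasurable F.gradD_meas)
    (fun t ht => (F.d_H1 t (Ioo_subset_Icc_self ht)).2.1 i j) fun t ht =>
      (integral_sq_entry_le_energy (u := v t) hΩo (F.d_H1 t (Ioo_subset_Icc_self ht)) i j).trans
        (mul_le_mul_of_nonneg_left (hC t (Ioo_subset_Icc_self ht)) zero_le_two)

theorem FlowFields.integrable_energy (F : FlowFields Ω T c v d) (hΩo : IsOpen Ω)
    [IsFiniteMeasure (vol Ω)] {C : ℝ} (hC : ∀ t ∈ Icc 0 T, energy Ω (v t) (d t) ≤ C) :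
    Integrable (fun t => energy Ω (v t) (d t)) (volume.restrict (Ioo 0 T)) := by
  have h1 := (memLp_two_iff_integrable_sq_norm F.v_meas).1 (F.memLp_velocity hC)
  have h2 := integrable_frob (F.memLp_gradD hΩo hC) (F.memLp_gradD hΩo hC)
  refine ((h1.integral_prod_left.const_mul (1 / 2)).add
    (h2.integral_prod_left.const_mul (1 / 2))).congr ?_
  filter_upwards [ae_restrict_mem measurableSet_Ioo] with t ht
  exact (energy_eq hΩo (F.d_H1 t (Ioo_subset_Icc_self ht))).symm

end

/-! ### Functions of bounded variation are bounded and integrable -/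

theorem BoundedVariationOn.exists_abs_le {E : ℝ → ℝ} {s : Set ℝ} (h : BoundedVariationOn E s) :
    ∃ C, ∀ t ∈ s, |E t| ≤ C := by
  rcases s.eq_empty_or_nonempty with rfl | ⟨a, ha⟩
  · exact ⟨0, by simp⟩
  · refine ⟨|E a| + (eVariationOn E s).toReal, fun t ht => ?_⟩
    have h1 := h.dist_le ht ha
    rw [Real.dist_eq] at h1
    have := abs_sub_abs_le_abs_sub (E t) (E a)
    linarith

theorem BoundedVariationOn.integrableOn_Icc {E : ℝ → ℝ} {a b : ℝ} (h : BoundedVariationOn E (Icc a b)) :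
    IntegrableOn E (Icc a b) := by
  obtain ⟨p, q, hp, hq, rfl⟩ := h.locallyBoundedVariationOn.exists_monotoneOn_sub_monotoneOn
  exact (hp.integrableOn_isCompact isCompact_Icc).sub (hq.integrableOn_isCompact isCompact_Icc)

/-! ### The weak form of the momentum balance -/

section

variable {Ω : Set E3} {T : ℝ} {c : Coefficients} {v d : ℝ → E3 → E3} {φ : ℝ → E3 → E3}

/-- The integrand of the weak form of the momentum balance for the test field `φ`. -/
def FlowFields.momentum (F : FlowFields Ω T c v d) (φ : ℝ → E3 → E3) (t : ℝ) (x : E3) : ℝ :=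
  frob (stressL c (d t x) (F.gradV t x) (F.w t x)) (grad (φ t) x)
    - frob (outer (v t x) (v t x) + (F.gradD t x)ᵀ * F.gradD t x) (grad (φ t) x)
    - inner ℝ (v t x) (timeDeriv φ t x)

/-- The density of the dissipation. -/
def FlowFields.dissipation (F : FlowFields Ω T c v d) (t : ℝ) (x : E3) : ℝ :=
  frob (stressD c (d t x) (F.gradV t x)) (F.gradV t x) + ‖F.w t x‖ ^ 2

theorem frob_add_left (A B C : Mat3) : frob (A + B) C = frob A C + frob B C := by
  simp only [frob, Matrix.add_apply, add_mul, Finset.sum_add_distrib]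

theorem frob_add_right (A B C : Mat3) : frob A (B + C) = frob A B + frob A C := by
  simp only [frob, Matrix.add_apply, mul_add, Finset.sum_add_distrib]

theorem frob_neg_right (A B : Mat3) : frob A (-B) = -frob A B := by
  simp only [frob, Matrix.neg_apply, mul_neg, Finset.sum_neg_distrib]

theorem frob_smul_right (A B : Mat3) (r : ℝ) : frob A (r • B) = r * frob A B := by
  simp only [frob, Matrix.smul_apply, smul_eq_mul, Finset.mul_sum, mul_left_comm]

theorem frob_zero_right (A : Mat3) : frob A 0 = 0 := by simp [frob]

theorem FlowFields.momentum_eq_zero (F : FlowFields Ω T c v d) (hφ : IsSpaceTimeTest Ω T φ) {t : ℝ}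
    {x : E3} (h : (t, x) ∉ tsupport (Function.uncurry φ)) : F.momentum φ t x = 0 := by
  have h1 : grad (φ t) x = 0 := hφ.grad_eq_zero h
  have h2 : timeDeriv φ t x = 0 := by
    rw [hφ.timeDeriv_eq, hφ.fderiv_eq_zero h]
    rfl
  rw [FlowFields.momentum, h1, h2, frob_zero_right, frob_zero_right, inner_zero_right]
  ring

theorem FlowFields.momentum_add (F : FlowFields Ω T c v d) {ψ : ℝ → E3 → E3}
    (hφ : IsSpaceTimeTest Ω T φ) (hψ : IsSpaceTimeTest Ω T ψ) (t : ℝ) (x : E3) :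
    F.momentum (φ + ψ) t x = F.momentum φ t x + F.momentum ψ t x := by
  simp only [FlowFields.momentum, hφ.grad_add hψ, hφ.timeDeriv_add hψ, frob_add_right, inner_add_right]
  ring

theorem FlowFields.momentum_smul (F : FlowFields Ω T c v d) (hφ : IsSpaceTimeTest Ω T φ) (r : ℝ)
    (t : ℝ) (x : E3) : F.momentum (r • φ) t x = r * F.momentum φ t x := by
  simp only [FlowFields.momentum, hφ.grad_smul, hφ.timeDeriv_smul, frob_smul_right, real_inner_smul_right]
  ring

theorem IsSpaceTimeTest.memLp_grad (hφ : IsSpaceTimeTest Ω T φ) {μ : Measure (ℝ × E3)} (i j : Fin 3) :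
    MemLp (fun z : ℝ × E3 => grad (φ z.1) z.2 i j) ⊤ μ := by
  obtain ⟨C, hC⟩ := hφ.exists_abs_grad_le
  exact memLp_top_of_bound ((continuous_entry i j).comp hφ.continuous_grad).aestronglyMeasurable C
    (Eventually.of_forall fun z => hC z.1 z.2 i j)

theorem memLp_top_of_hasCompactSupport {μ : Measure (ℝ × E3)} {f : ℝ × E3 → E3} (hf : Continuous f)
    (hs : HasCompactSupport f) (i : Fin 3) : MemLp (fun z => f z i) ⊤ μ := by
  obtain ⟨C, hC⟩ := hs.exists_bound_of_continuous hf
  exact memLp_apply (memLp_top_of_bound hf.aestronglyMeasurable C (Eventually.of_forall hC)) i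

variable [IsFiniteMeasure (vol Ω)] {C : ℝ}

theorem FlowFields.memLp_stressD (F : FlowFields Ω T c v d) (i j : Fin 3) :
    MemLp (fun z : ℝ × E3 => stressD c (d z.1 z.2) (F.gradV z.1 z.2) i j) 2 (cyl Ω T) :=
  EricksenLeslie.memLp_stressD (d := fun z : ℝ × E3 => d z.1 z.2)
    (G := fun z : ℝ × E3 => F.gradV z.1 z.2) c F.memLp_director F.gradV_mem i j

theorem FlowFields.memLp_stressL (F : FlowFields Ω T c v d) (i j : Fin 3) :
    MemLp (fun z : ℝ × E3 => stressL c (d z.1 z.2) (F.gradV z.1 z.2) (F.w z.1 z.2) i j) 2 (cyl Ω T) :=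
  (F.memLp_stressD i j).add (memLp_stressElastic (d := fun z : ℝ × E3 => d z.1 z.2)
    (w := fun z : ℝ × E3 => F.w z.1 z.2) c F.memLp_director (memLp_apply F.w_mem) i j)

theorem FlowFields.integrable_dissipation (F : FlowFields Ω T c v d) :
    Integrable (fun z : ℝ × E3 => F.dissipation z.1 z.2) (cyl Ω T) :=
  (integrable_frob (A := fun z : ℝ × E3 => stressD c (d z.1 z.2) (F.gradV z.1 z.2))
    (B := fun z : ℝ × E3 => F.gradV z.1 z.2) F.memLp_stressD F.gradV_mem).add
    ((memLp_two_iff_integrable_sq_norm F.w_mem.1).1 F.w_mem)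

theorem FlowFields.integrable_inner_timeDeriv (F : FlowFields Ω T c v d) (hφ : IsSpaceTimeTest Ω T φ)
    (hC : ∀ t ∈ Icc 0 T, energy Ω (v t) (d t) ≤ C) :
    Integrable (fun z : ℝ × E3 => inner ℝ (v z.1 z.2) (timeDeriv φ z.1 z.2)) (cyl Ω T) :=
  integrable_inner_top (a := fun z : ℝ × E3 => v z.1 z.2) (b := fun z : ℝ × E3 => timeDeriv φ z.1 z.2)
    (fun i => (memLp_apply (F.memLp_velocity hC) i).integrable one_le_two)
    (memLp_top_of_hasCompactSupport hφ.continuous_timeDeriv hφ.hasCompactSupport_timeDeriv)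

theorem FlowFields.integrable_convective (F : FlowFields Ω T c v d) (hφ : IsSpaceTimeTest Ω T φ)
    (hC : ∀ t ∈ Icc 0 T, energy Ω (v t) (d t) ≤ C) :
    Integrable (fun z : ℝ × E3 => inner ℝ (mv (F.gradV z.1 z.2) (v z.1 z.2)) (φ z.1 z.2)) (cyl Ω T) :=
  integrable_inner_top (a := fun z : ℝ × E3 => mv (F.gradV z.1 z.2) (v z.1 z.2))
    (b := fun z : ℝ × E3 => φ z.1 z.2)
    (integrable_mv (A := fun z : ℝ × E3 => F.gradV z.1 z.2) (a := fun z : ℝ × E3 => v z.1 z.2)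
      F.gradV_mem (memLp_apply (F.memLp_velocity hC)))
    (memLp_top_of_hasCompactSupport hφ.1.continuous hφ.2.1)

theorem FlowFields.integrable_outer (F : FlowFields Ω T c v d) (hφ : IsSpaceTimeTest Ω T φ)
    (hC : ∀ t ∈ Icc 0 T, energy Ω (v t) (d t) ≤ C) :
    Integrable (fun z : ℝ × E3 => frob (outer (v z.1 z.2) (v z.1 z.2)) (grad (φ z.1) z.2)) (cyl Ω T) :=
  integrable_frob_top (A := fun z : ℝ × E3 => outer (v z.1 z.2) (v z.1 z.2))
    (B := fun z : ℝ × E3 => grad (φ z.1) z.2)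
    (EricksenLeslie.integrable_outer (a := fun z : ℝ × E3 => v z.1 z.2)
      (memLp_apply (F.memLp_velocity hC))) hφ.memLp_grad

theorem FlowFields.integrable_momentum (F : FlowFields Ω T c v d) (hΩo : IsOpen Ω)
    (hφ : IsSpaceTimeTest Ω T φ) (hC : ∀ t ∈ Icc 0 T, energy Ω (v t) (d t) ≤ C) :
    Integrable (fun z : ℝ × E3 => F.momentum φ z.1 z.2) (cyl Ω T) := by
  have h1 := integrable_frob_top
    (A := fun z : ℝ × E3 => stressL c (d z.1 z.2) (F.gradV z.1 z.2) (F.w z.1 z.2))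
    (B := fun z : ℝ × E3 => grad (φ z.1) z.2)
    (fun i j => (F.memLp_stressL i j).integrable one_le_two) hφ.memLp_grad
  have h2 := integrable_frob_top
    (A := fun z : ℝ × E3 => (F.gradD z.1 z.2)ᵀ * F.gradD z.1 z.2)
    (B := fun z : ℝ × E3 => grad (φ z.1) z.2)
    (integrable_transpose_mul_self (A := fun z : ℝ × E3 => F.gradD z.1 z.2) (F.memLp_gradD hΩo hC))
    hφ.memLp_grad
  simp only [FlowFields.momentum, frob_add_left]
  exact (h1.sub ((F.integrable_outer hφ hC).add h2)).sub (F.integrable_inner_timeDeriv hφ hC)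

/-- The weak form of the momentum balance as a linear functional of the test field. -/
def FlowFields.momentumFunctional (F : FlowFields Ω T c v d) (hΩo : IsOpen Ω)
    (hC : ∀ t ∈ Icc 0 T, energy Ω (v t) (d t) ≤ C) : solenoidalTests Ω T →ₗ[ℝ] ℝ where
  toFun φ := ∫ t in Ioo 0 T, ∫ x in Ω, F.momentum φ.1 t x
  map_add' φ ψ := by
    have h1 := F.integrable_momentum hΩo φ.2.1 hC
    have h2 := F.integrable_momentum hΩo ψ.2.1 hC
    rw [← integral_add h1.integral_prod_left h2.integral_prod_left]
    refine integral_congr_ae ?_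
    filter_upwards [h1.prod_right_ae, h2.prod_right_ae] with t h3 h4
    rw [← integral_add h3 h4]
    exact integral_congr_ae (Eventually.of_forall fun x => F.momentum_add φ.2.1 ψ.2.1 t x)
  map_smul' r φ := by
    rw [RingHom.id_apply, smul_eq_mul, ← integral_const_mul]
    refine integral_congr_ae (Eventually.of_forall fun t => ?_)
    simp only
    rw [← integral_const_mul]
    exact integral_congr_ae (Eventually.of_forall fun x => F.momentum_smul φ.2.1 r t x)

/-- The slicewise form of the integrand of the energy-variational inequality. -/
theorem FlowFields.ae_integral_eq (F : FlowFields Ω T c v d) (hΩo : IsOpen Ω)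
    (hφ : IsSpaceTimeTest Ω T φ) (hC : ∀ t ∈ Icc 0 T, energy Ω (v t) (d t) ≤ C) :
    ∀ᵐ τ ∂volume.restrict (Ioo 0 T),
      ∫ x in Ω, (-inner ℝ (mv (F.gradV τ x) (v τ x)) ((-φ) τ x)
          + frob ((F.gradD τ x)ᵀ * F.gradD τ x) (grad ((-φ) τ) x)
          + frob (stressD c (d τ x) (F.gradV τ x)) (F.gradV τ x - grad ((-φ) τ) x)
          + ‖F.w τ x‖ ^ 2
          - frob (stressElastic c (d τ x) (F.w τ x)) (grad ((-φ) τ) x))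
        = (∫ x in Ω, F.momentum φ τ x) + (∫ x in Ω, F.dissipation τ x)
          + ∫ x in Ω, inner ℝ (v τ x) (timeDeriv φ τ x) := by
  filter_upwards [F.v_H1, (F.integrable_momentum hΩo hφ hC).prod_right_ae,
    F.integrable_dissipation.prod_right_ae, (F.integrable_inner_timeDeriv hφ hC).prod_right_ae,
    (F.integrable_convective hφ hC).prod_right_ae, (F.integrable_outer hφ hC).prod_right_ae]
    with τ hv h1 h2 h3 h4 h5
  have hconv := integral_convective hv (hφ.isTest τ)
  -- The last bracket integrates to zero by `hconv`; the term with `timeDeriv` compensates the one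
  -- contained in `momentum`.
  have e : ∀ x, -inner ℝ (mv (F.gradV τ x) (v τ x)) ((-φ) τ x)
      + frob ((F.gradD τ x)ᵀ * F.gradD τ x) (grad ((-φ) τ) x)
      + frob (stressD c (d τ x) (F.gradV τ x)) (F.gradV τ x - grad ((-φ) τ) x)
      + ‖F.w τ x‖ ^ 2
      - frob (stressElastic c (d τ x) (F.w τ x)) (grad ((-φ) τ) x)
      = F.momentum φ τ x + F.dissipation τ x + inner ℝ (v τ x) (timeDeriv φ τ x)
        + (inner ℝ (mv (F.gradV τ x) (v τ x)) (φ τ x)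
          + frob (outer (v τ x) (v τ x)) (grad (φ τ) x)) := fun x => by
    have : (-φ) τ x = -φ τ x := rfl
    rw [grad_neg_apply hφ, this, FlowFields.momentum, FlowFields.dissipation, sub_neg_eq_add,
      frob_add_right, frob_neg_right, frob_neg_right, inner_neg_right, stressL, frob_add_left,
      frob_add_left]
    ring
  have h12 : Integrable (fun x => F.momentum φ τ x + F.dissipation τ x) (vol Ω) := h1.add h2
  have h123 : Integrable (fun x => F.momentum φ τ x + F.dissipation τ x
      + inner ℝ (v τ x) (timeDeriv φ τ x)) (vol Ω) := h12.add h3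
  have h45 : Integrable (fun x => inner ℝ (mv (F.gradV τ x) (v τ x)) (φ τ x)
      + frob (outer (v τ x) (v τ x)) (grad (φ τ) x)) (vol Ω) := h4.add h5
  rw [integral_congr_ae (Eventually.of_forall e), integral_add h123 h45,
    integral_add h12 h3, integral_add h1 h2, integral_add h4 h5, hconv]
  ring

end

/-! ### Consequences of the energy-variational inequality -/

section

open scoped CompactlySupported

variable {Ω : Set E3} {T : ℝ} {c : Coefficients} {v d : ℝ → E3 → E3} {E : ℝ → ℝ}

theorem weight_nonneg (G : E3 → Mat3) : 0 ≤ weight Ω G :=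
  mul_nonneg zero_le_two ENNReal.toReal_nonneg

/-- The energy-variational inequality from the initial time, for test fields that vanish at the
final time. -/
theorem FlowFields.momentum_add_dissipation_le (F : FlowFields Ω T c v d) (hΩo : IsOpen Ω)
    (hΩ : Bornology.IsBounded Ω) [CompactSpace (Directions Ω)]
    (hF : ∀ u G L, IsAdmissibleTest Ω T u G L →
      ∀ s t, 0 ≤ s → s < t → t < T → EnergyVariationalInequality F E u G L s t)
    {C : ℝ} (hC : ∀ t ∈ Icc 0 T, energy Ω (v t) (d t) ≤ C)
    (hE : ∀ t ∈ Icc 0 T, energy Ω (v t) (d t) ≤ E t)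
    (hf : Integrable (fun t => E t - energy Ω (v t) (d t)) (volume.restrict (Ioo 0 T)))
    (φ : solenoidalTests Ω T) {t : ℝ} (ht : t ∈ Ioo 0 T) (hφt : ∀ x, φ.1 t x = 0) :
    E t - E 0 + (∫ τ in Ioc 0 t, ∫ x in Ω, F.momentum φ.1 τ x)
      + (∫ τ in Ioc 0 t, ∫ x in Ω, F.dissipation τ x)
      ≤ 2 * weightedPosSup (volume.restrict (Ioo 0 T)) (fun t => E t - energy Ω (v t) (d t))
        (gradForm Ω T hΩ φ) := by
  have := isFiniteMeasure_vol hΩ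
  have hsub : Ioc 0 t ⊆ Ioo 0 T := fun τ hτ => ⟨hτ.1, hτ.2.trans_lt ht.2⟩
  have hφ := φ.2.1
  -- With `-φ` as test field the stress enters with the sign of the momentum balance.
  have hneg : -φ.1 ∈ solenoidalTests Ω T := neg_mem φ.2
  have H := hF _ _ _ (isAdmissibleTest_of_mem hΩ hneg) 0 t le_rfl ht.1 ht.2
  unfold EnergyVariationalInequality at H
  have hφ0 : ∀ x, φ.1 0 x = 0 := fun x =>
    image_eq_zero_of_notMem_tsupport (f := Function.uncurry φ.1) (hφ.eq_zero_of_notMem (t := 0) (by simp) x)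
  have z0 : ∫ x in Ω, inner ℝ (v 0 x) ((-φ.1) 0 x) = 0 := by simp [hφ0]
  have zt : ∫ x in Ω, inner ℝ (v t x) ((-φ.1) t x) = 0 := by simp [hφt]
  have hl : leftValue E 0 = E 0 := by simp [leftValue]
  rw [z0, zt, hl, intervalIntegral.integral_of_le ht.1.le, intervalIntegral.integral_of_le ht.1.le,
    intervalIntegral.integral_of_le ht.1.le] at H
  have hI := F.integrable_inner_timeDeriv hφ hC
  have iI : IntegrableOn (fun τ => ∫ x in Ω, inner ℝ (v τ x) (timeDeriv φ.1 τ x)) (Ioc 0 t) :=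
    IntegrableOn.mono_set (t := Ioo 0 T) hI.integral_prod_left hsub
  have iM : IntegrableOn (fun τ => ∫ x in Ω, F.momentum φ.1 τ x) (Ioc 0 t) :=
    IntegrableOn.mono_set (t := Ioo 0 T) (F.integrable_momentum hΩo hφ hC).integral_prod_left hsub
  have iD : IntegrableOn (fun τ => ∫ x in Ω, F.dissipation τ x) (Ioc 0 t) :=
    IntegrableOn.mono_set (t := Ioo 0 T) F.integrable_dissipation.integral_prod_left hsub
  -- The duality pairing contributes `-∫ v · ∂ₜφ`, which cancels the last term of `e3`.
  have e1 : ∫ τ in Ioc 0 t, derivWithin (fun t => dualEmbedding Ω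
      (toLpCurve 2 (vol Ω) hneg.1.1.continuous hneg.1.2.1 t)) (Icc 0 T) τ
        (toH10sigma Ω (v τ) (F.gradV τ))
      = -∫ τ in Ioc 0 t, ∫ x in Ω, inner ℝ (v τ x) (timeDeriv φ.1 τ x) := by
    rw [← integral_neg]
    refine integral_congr_ae ?_
    filter_upwards [ae_restrict_of_ae_restrict_of_subset hsub F.v_H1,
      ae_restrict_mem measurableSet_Ioc] with τ hv hτ
    rw [derivWithin_dualEmbedding_apply hneg (hsub hτ) hv, ← integral_neg]
    refine integral_congr_ae (Eventually.of_forall fun x => ?_)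
    simp only
    rw [← neg_one_smul ℝ φ.1, hφ.timeDeriv_smul, neg_one_smul, inner_neg_right]
  have e2 := integral_congr_ae (ae_restrict_of_ae_restrict_of_subset hsub (F.ae_integral_eq hΩo hφ hC))
  have e3 : ∫ τ in Ioc 0 t, ((∫ x in Ω, F.momentum φ.1 τ x) + (∫ x in Ω, F.dissipation τ x)
      + ∫ x in Ω, inner ℝ (v τ x) (timeDeriv φ.1 τ x))
      = (∫ τ in Ioc 0 t, ∫ x in Ω, F.momentum φ.1 τ x) + (∫ τ in Ioc 0 t, ∫ x in Ω, F.dissipation τ x)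
        + ∫ τ in Ioc 0 t, ∫ x in Ω, inner ℝ (v τ x) (timeDeriv φ.1 τ x) := by
    have iMD : IntegrableOn (fun τ => (∫ x in Ω, F.momentum φ.1 τ x) + (∫ x in Ω, F.dissipation τ x))
        (Ioc 0 t) := iM.add iD
    rw [integral_add iMD iI, integral_add iM iD]
  have hg := (integrable_mul_posSup hf (gradForm Ω T hΩ φ)).const_mul 2
  have hg0 : ∀ τ ∈ Ioo 0 T, 0 ≤ 2 * ((E τ - energy Ω (v τ) (d τ))
      * posSup (slice (gradForm Ω T hΩ φ) τ)) := fun τ hτ =>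
    mul_nonneg zero_le_two (mul_nonneg (sub_nonneg.2 (hE τ (Ioo_subset_Icc_self hτ))) (posSup_nonneg _))
  -- Since `E ≥ ℰ(v,d)`, the weight may be replaced by its upper bound and the time interval
  -- enlarged to `(0,T)`.
  have e4 : -(∫ τ in Ioc 0 t, weight Ω (grad ((-φ.1) τ)) * (energy Ω (v τ) (d τ) - E τ))
      ≤ 2 * weightedPosSup (volume.restrict (Ioo 0 T)) (fun t => E t - energy Ω (v t) (d t))
        (gradForm Ω T hΩ φ) := by
    rw [← integral_neg, weightedPosSup, ← integral_const_mul]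
    refine le_trans (integral_mono_of_nonneg ?_ (IntegrableOn.mono_set (t := Ioo 0 T) hg hsub) ?_)
      (setIntegral_mono_set hg ?_ hsub.eventuallyLE)
    · filter_upwards [ae_restrict_mem measurableSet_Ioc] with τ hτ
      have h1 := hE τ (Ioo_subset_Icc_self (hsub hτ))
      have h2 := weight_nonneg (Ω := Ω) (grad ((-φ.1) τ))
      simp only [Pi.zero_apply]
      nlinarith
    · filter_upwards [ae_restrict_mem measurableSet_Ioc] with τ hτ
      have h1 := hE τ (Ioo_subset_Icc_self (hsub hτ))
      have h2 := weight_neg_le hΩ φ τ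
      nlinarith
    · filter_upwards [ae_restrict_mem measurableSet_Ioo] with τ hτ
      exact hg0 τ hτ
  rw [e1] at H
  rw [e2, e3] at H
  linarith

/-- A space-time test field vanishes near the final time. -/
theorem IsSpaceTimeTest.exists_forall_notMem_tsupport {φ : ℝ → E3 → E3} (hφ : IsSpaceTimeTest Ω T φ)
    (hT : 0 < T) :
    ∃ t ∈ Ioo 0 T, ∀ τ, t ≤ τ → ∀ x, (τ, x) ∉ tsupport (Function.uncurry φ) := by
  -- The point `T / 2` keeps the set nonempty when the support is empty.
  have hK : IsCompact (insert (T / 2) (Prod.fst '' tsupport (Function.uncurry φ))) :=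
    (hφ.2.1.isCompact.image continuous_fst).insert _
  obtain ⟨b, hb, hmax⟩ := hK.exists_isGreatest (insert_nonempty _ _)
  have hbT : b ∈ Ioo 0 T := by
    rcases hb with rfl | ⟨z, hz, rfl⟩
    · exact ⟨by linarith, by linarith⟩
    · exact (hφ.2.2 hz).1
  refine ⟨(b + T) / 2, ⟨by linarith [hbT.1], by linarith [hbT.2]⟩, fun τ hτ x hx => ?_⟩
  have := hmax (mem_insert_of_mem _ ⟨_, hx, rfl⟩)
  simp only at this
  linarith [hbT.2]

/-- Scaling: for `rφ` with `r > 0` the momentum and weight terms are multiplied by `r`, while the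
energy and dissipation terms stay fixed. The final time depends on `φ` only, so `r → ∞` leaves the
homogeneous inequality. -/
theorem FlowFields.momentumFunctional_le (F : FlowFields Ω T c v d) (hΩo : IsOpen Ω)
    (hΩ : Bornology.IsBounded Ω) [IsFiniteMeasure (vol Ω)] [CompactSpace (Directions Ω)] (hT : 0 < T)
    (hF : ∀ u G L, IsAdmissibleTest Ω T u G L →
      ∀ s t, 0 ≤ s → s < t → t < T → EnergyVariationalInequality F E u G L s t)
    {C : ℝ} (hC : ∀ t ∈ Icc 0 T, energy Ω (v t) (d t) ≤ C)
    (hE : ∀ t ∈ Icc 0 T, energy Ω (v t) (d t) ≤ E t)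
    (hf : Integrable (fun t => E t - energy Ω (v t) (d t)) (volume.restrict (Ioo 0 T)))
    (φ : solenoidalTests Ω T) :
    F.momentumFunctional hΩo hC φ
      ≤ 2 * weightedPosSup (volume.restrict (Ioo 0 T)) (fun t => E t - energy Ω (v t) (d t))
        (gradForm Ω T hΩ φ) := by
  obtain ⟨t, ht, hφt⟩ := φ.2.1.exists_forall_notMem_tsupport hT
  have hsub : Ioc 0 t ⊆ Ioo 0 T := fun τ hτ => ⟨hτ.1, hτ.2.trans_lt ht.2⟩
  have hl : ∀ r : ℝ, ∫ τ in Ioc 0 t, ∫ x in Ω, F.momentum (r • φ).1 τ x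
      = r * F.momentumFunctional hΩo hC φ := fun r => by
    rw [← smul_eq_mul, ← map_smul]
    refine (setIntegral_eq_of_subset_of_forall_sdiff_eq_zero measurableSet_Ioo hsub
      fun τ hτ => ?_).symm
    have hτt : t ≤ τ := le_of_not_ge fun h => hτ.2 ⟨hτ.1.1, h⟩
    refine integral_eq_zero_of_ae (Eventually.of_forall fun x => ?_)
    have h0 := F.momentum_eq_zero φ.2.1 (hφt τ hτt x)
    have h1 := F.momentum_smul φ.2.1 r τ x
    rw [h0, mul_zero] at h1
    exact h1
  have key : ∀ r : ℝ, 0 < r → E t - E 0 + (∫ τ in Ioc 0 t, ∫ x in Ω, F.dissipation τ x)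
      ≤ r * (2 * weightedPosSup (volume.restrict (Ioo 0 T)) (fun t => E t - energy Ω (v t) (d t))
        (gradForm Ω T hΩ φ) - F.momentumFunctional hΩo hC φ) := fun r hr => by
    have h := F.momentum_add_dissipation_le hΩo hΩ hF hC hE hf (r • φ) ht fun x => by
      have : φ.1 t x = 0 :=
        image_eq_zero_of_notMem_tsupport (f := Function.uncurry φ.1) (hφt t le_rfl x)
      change r • φ.1 t x = 0
      rw [this, smul_zero]
    rw [hl, map_smul, weightedPosSup_smul hr] at h
    linarith
  by_contra! hlt
  set A := E t - E 0 + ∫ τ in Ioc 0 t, ∫ x in Ω, F.dissipation τ x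
  set B := 2 * weightedPosSup (volume.restrict (Ioo 0 T)) (fun t => E t - energy Ω (v t) (d t))
        (gradForm Ω T hΩ φ) - F.momentumFunctional hΩo hC φ with hB
  have hB0 : B < 0 := by linarith
  -- This `r` makes `r * B = -(|A| + 1)`, and `A ≤ -(|A| + 1)` is impossible.
  have h1 := key ((|A| + 1) / (-B)) (div_pos (by positivity) (by linarith))
  rw [div_mul_eq_mul_div, div_neg, mul_div_assoc, div_self hB0.ne, mul_one] at h1
  linarith [neg_abs_le A]

/-- The test field `0` suffices: its momentum, boundary and weight terms vanish. -/
theorem FlowFields.energy_add_dissipation_le (F : FlowFields Ω T c v d) (hΩo : IsOpen Ω)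
    (hΩ : Bornology.IsBounded Ω) [CompactSpace (Directions Ω)]
    (hF : ∀ u G L, IsAdmissibleTest Ω T u G L →
      ∀ s t, 0 ≤ s → s < t → t < T → EnergyVariationalInequality F E u G L s t)
    {C : ℝ} (hC : ∀ t ∈ Icc 0 T, energy Ω (v t) (d t) ≤ C)
    (hE : ∀ t ∈ Icc 0 T, energy Ω (v t) (d t) ≤ E t)
    (hf : Integrable (fun t => E t - energy Ω (v t) (d t)) (volume.restrict (Ioo 0 T)))
    {t : ℝ} (ht : t ∈ Ioo 0 T) :
    E t - E 0 + (∫ τ in Ioc 0 t, ∫ x in Ω, F.dissipation τ x) ≤ 0 := by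
  have h := F.momentum_add_dissipation_le hΩo hΩ hF hC hE hf 0 ht fun x => rfl
  have h0 : ∀ τ x, F.momentum 0 τ x = 0 := fun τ x =>
    F.momentum_eq_zero isSpaceTimeTest_zero (by
      rw [show Function.uncurry (0 : ℝ → E3 → E3) = 0 from rfl, tsupport_zero]
      exact notMem_empty _)
  rw [map_zero, weightedPosSup_of_nonpos le_rfl] at h
  simpa [h0] using h

end

/-! ### The defect measure -/

section

variable {Ω : Set E3} {T : ℝ} {κ : ProbabilityTheory.Kernel ℝ (Directions Ω)} {k : ℝ → ℝ}

/-- The matrix-valued measure `B ↦ k(t) ∫_{B × 𝕊²} ξ ⊗ ξ dκ_t(x, ξ)`. -/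
def defectMeasure (κ : ProbabilityTheory.Kernel ℝ (Directions Ω)) (k : ℝ → ℝ) (t : ℝ) :
    VectorMeasure E3 Mat3 :=
  secondMoment (Real.toNNReal (k t) • κ t) (fun y : Directions Ω => (y.1 : E3)) fun y => (y.2 : E3)

theorem measurable_point : Measurable fun y : Directions Ω => (y.1 : E3) :=
  measurable_subtype_coe.comp measurable_fst

theorem measurable_direction : Measurable fun y : Directions Ω => (y.2 : E3) :=
  measurable_subtype_coe.comp measurable_snd

theorem norm_direction (y : Directions Ω) : ‖(y.2 : E3)‖ = 1 := by simp

theorem frob_one_outer {ξ : E3} (hξ : ‖ξ‖ = 1) : frob 1 (outer ξ ξ) = 1 := by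
  have h : inner ℝ ξ ξ = (1 : ℝ) := by rw [real_inner_self_eq_norm_sq, hξ, one_pow]
  have h1 : mv 1 ξ = ξ := by simp [mv]
  rw [frob_outer, h1, h]

variable [ProbabilityTheory.IsMarkovKernel κ]

theorem matInt_defectMeasure (hΩ : Bornology.IsBounded Ω) (hk : ∀ t, 0 ≤ k t) {A : E3 → Mat3}
    (hA : ContinuousOn A (closure Ω)) (t : ℝ) :
    matInt (defectMeasure κ k t) A = k t * ∫ y, frob (A y.1) (outer y.2 y.2) ∂κ t := by
  rw [defectMeasure, matInt_secondMoment measurable_point measurable_direction norm_direction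
    hΩ.isCompact_closure (fun y => y.1.2) hA, integral_smul_nnreal_measure, NNReal.smul_def,
    Real.coe_toNNReal _ (hk t), smul_eq_mul]

theorem matInt_defectMeasure_one (hΩ : Bornology.IsBounded Ω) (hk : ∀ t, 0 ≤ k t) (t : ℝ) :
    matInt (defectMeasure κ k t) (fun _ => 1) = k t := by
  rw [matInt_defectMeasure hΩ hk continuousOn_const]
  simp only [frob_one_outer (norm_direction _)]
  simp

theorem trace_defectMeasure (hk : ∀ t, 0 ≤ k t) (t : ℝ) :
    (defectMeasure κ k t (closure Ω)).trace = k t := by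
  have hpre : (fun y : Directions Ω => (y.1 : E3)) ⁻¹' closure Ω = univ :=
    eq_univ_of_forall fun y => y.1.2
  simp only [Matrix.trace, Matrix.diag_apply, defectMeasure]
  simp only [secondMoment_apply measurable_point measurable_direction norm_direction
    isClosed_closure.measurableSet, hpre, Measure.restrict_univ]
  rw [← integral_finsetSum _ fun i _ => integrable_moment measurable_direction norm_direction i i]
  have h : ∀ y : Directions Ω, ∑ i, (y.2 : E3) i * (y.2 : E3) i = 1 := fun y => by
    have := EuclideanSpace.real_norm_sq_eq (y.2 : E3)
    rw [norm_direction, one_pow] at this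
    simp only [← sq, ← this]
  simp only [h]
  simp [hk t]

/-- For unit `ξ` one has `|ξ · Aξ| ≤ |A|₂`, and `κ t` is a probability measure, so the dual norm is
at most `k t`. Weak-star measurability is the measurability of integrals against a kernel. -/
theorem isDefectMeasure_defectMeasure (hΩ : Bornology.IsBounded Ω) (hk : ∀ t, 0 ≤ k t)
    (hkm : Measurable k) {C : ℝ} (hC : ∀ᵐ t ∂volume.restrict (Ioo 0 T), k t ≤ C) :
    IsDefectMeasure Ω T (defectMeasure κ k) where
  supported t _ B hB hd := by
    have hpre : (fun y : Directions Ω => (y.1 : E3)) ⁻¹' B = ∅ :=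
      eq_empty_of_forall_notMem fun y hy => disjoint_left.1 hd hy y.1.2
    ext i j
    rw [defectMeasure, secondMoment_apply measurable_point measurable_direction norm_direction hB, hpre]
    simp
  posSemidef t _ B hB := posSemidef_secondMoment measurable_point measurable_direction norm_direction hB
  measurable A hA := by
    simp only [matInt_defectMeasure hΩ hk hA]
    have hc : Continuous fun y : Directions Ω => frob (A y.1) (outer (y.2 : E3) y.2) :=
      continuous_frob (hA.comp_continuous (continuous_subtype_val.comp continuous_fst) fun y => y.1.2)
        (continuous_outer_self.comp (continuous_subtype_val.comp continuous_snd))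
    exact (hkm.stronglyMeasurable.mul
      (StronglyMeasurable.integral_kernel hc.stronglyMeasurable)).aestronglyMeasurable
  bounded := by
    refine ⟨C, ?_⟩
    filter_upwards [hC] with t ht A hA hA1
    rw [matInt_defectMeasure hΩ hk hA, abs_mul, abs_of_nonneg (hk t)]
    have h1 : |∫ y, frob (A y.1) (outer (y.2 : E3) y.2) ∂κ t| ≤ 1 := by
      have := norm_integral_le_of_norm_le_const (μ := κ t) (C := 1)
        (f := fun y : Directions Ω => frob (A y.1) (outer (y.2 : E3) y.2))
        (Eventually.of_forall fun y => (frob_outer_le _ _ (norm_direction y)).trans (hA1 _ y.1.2))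
      simpa using this
    exact (mul_le_of_le_one_right (hk t) h1).trans ht

end

/-- `T^D` is symmetric. This reconciles `T^D : ∇v` in the energy-variational inequality with `T^D :
(∇v)_sym` in the energy inequality. -/
theorem frob_stressD_symPart (c : Coefficients) (d : E3) (G : Mat3) :
    frob (stressD c d G) (symPart G) = frob (stressD c d G) G := by
  have h : (stressD c d G)ᵀ = stressD c d G := by
    ext i j
    simp only [stressD, symPart, outer, Matrix.transpose_apply, Matrix.add_apply, Matrix.smul_apply,
      Matrix.of_apply, smul_eq_mul]
    ring
  have h' : ∀ i j, stressD c d G i j = stressD c d G j i := fun i j => congrFun (congrFun h j) i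
  generalize stressD c d G = S at h'
  simp only [frob, symPart, Matrix.smul_apply, Matrix.add_apply, Matrix.transpose_apply, smul_eq_mul,
    Fin.sum_univ_three]
  rw [h' 1 0, h' 2 0, h' 2 1]
  ring

end EricksenLeslie

end

/-! ### Assembly of the theorem -/

theorem theorem2p2 (Ω : Set EricksenLeslie.E3) (hΩ_open : IsOpen Ω) (hΩ_conn : IsConnected Ω)
    (hΩ_bdd : Bornology.IsBounded Ω) (T : ℝ) (hT : 0 < T) (c : EricksenLeslie.Coefficients)
    (v₀ d₀ dΓ : EricksenLeslie.E3 → EricksenLeslie.E3)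
    (v d : ℝ → EricksenLeslie.E3 → EricksenLeslie.E3) (E : ℝ → ℝ)
    (hsol : EricksenLeslie.IsEnergyVariationalSolution Ω T c v₀ d₀ dΓ v d E)
    (hE0 : E 0 = EricksenLeslie.energy Ω v₀ d₀) :
    ∃ m : ℝ → MeasureTheory.VectorMeasure EricksenLeslie.E3 EricksenLeslie.Mat3,
      EricksenLeslie.IsMeasureValuedSolution Ω T c v d m ∧
      ∀ᵐ t ∂MeasureTheory.volume.restrict (Set.Ioo 0 T),
        1 / 2 * EricksenLeslie.matInt (m t) (fun _ => 1) = 1 / 2 * (m t (closure Ω)).trace ∧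
        1 / 2 * EricksenLeslie.matInt (m t) (fun _ => 1)
          ≤ E t - EricksenLeslie.energy Ω (v t) (d t) := by
  open EricksenLeslie in
  obtain ⟨hBV, hE, hv0, hd0, -, F, hF⟩ := hsol
  have := isFiniteMeasure_vol hΩ_bdd
  have := compactSpace_directions hΩ_bdd
  have := standardBorelSpace_directions (Ω := Ω)
  have := nonempty_directions hΩ_conn.nonempty
  obtain ⟨C, hEC⟩ := EricksenLeslie.BoundedVariationOn.exists_abs_le hBV
  have hC : ∀ t ∈ Icc 0 T, energy Ω (v t) (d t) ≤ C := fun t ht =>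
    (hE t ht).trans ((le_abs_self _).trans (hEC t ht))
  have hf : Integrable (fun t => E t - energy Ω (v t) (d t)) (volume.restrict (Ioo 0 T)) :=
    ((EricksenLeslie.BoundedVariationOn.integrableOn_Icc hBV).mono_set Ioo_subset_Icc_self).sub
      (F.integrable_energy hΩ_open hC)
  have hf0 : 0 ≤ᵐ[volume.restrict (Ioo 0 T)] fun t => E t - energy Ω (v t) (d t) := by
    filter_upwards [ae_restrict_mem measurableSet_Ioo] with t ht
    exact sub_nonneg.2 (hE t (Ioo_subset_Icc_self ht))
  -- The factor `1 / 2` matches the factor `2` in front of the defect term, both here and in the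
  -- weight.
  obtain ⟨κ, k, hκ, hkm, hk0, hkf, hrep⟩ := exists_kernel_representation hf hf0
    (gradForm Ω T hΩ_bdd) ((1 / 2 : ℝ) • F.momentumFunctional hΩ_open hC) fun φ => by
      have h := F.momentumFunctional_le hΩ_open hΩ_bdd hT hF hC hE hf φ
      rw [LinearMap.smul_apply, smul_eq_mul]
      linarith
  have hkC : ∀ᵐ t ∂volume.restrict (Ioo 0 T), k t ≤ C := by
    filter_upwards [hkf, ae_restrict_mem measurableSet_Ioo] with t h1 ht
    have h2 := hEC t (Ioo_subset_Icc_self ht)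
    have h3 := energy_nonneg (Ω := Ω) (v t) (d t)
    linarith [le_abs_self (E t)]
  have h1 := fun t => matInt_defectMeasure_one (κ := κ) hΩ_bdd hk0 t
  refine ⟨defectMeasure κ k, ⟨isDefectMeasure_defectMeasure hΩ_bdd hk0 hkm hkC, F, ?_, ?_⟩, ?_⟩
  · intro φ hφ hdiv
    have hmem : φ ∈ solenoidalTests Ω T := ⟨hφ, hdiv⟩
    obtain ⟨hint, heq⟩ := hrep ⟨φ, hmem⟩
    have hm : ∀ t, matInt (defectMeasure κ k t) (fun x => symPart (grad (φ t) x))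
        = k t * ∫ y, gradForm Ω T hΩ_bdd ⟨φ, hmem⟩ (t, y) ∂κ t := fun t => by
      have hc : Continuous fun x => symPart (grad (φ t) x) :=
        continuous_symPart.comp (hφ.continuous_grad.comp
          (by fun_prop : Continuous fun x : E3 => (t, x)))
      rw [matInt_defectMeasure hΩ_bdd hk0 hc.continuousOn]
      simp only [frob_symPart_outer, gradForm_apply]
    simp only [hm]
    rw [intervalIntegral.integral_of_le hT.le, integral_Ioc_eq_integral_Ioo]
    refine (integral_sub (F.integrable_momentum hΩ_open hφ hC).integral_prod_left
      (hint.const_mul 2)).trans ?_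
    rw [integral_const_mul, ← heq]
    change F.momentumFunctional hΩ_open hC ⟨φ, hmem⟩
      - 2 * (1 / 2 * F.momentumFunctional hΩ_open hC ⟨φ, hmem⟩) = 0
    ring
  · filter_upwards [hkf, ae_restrict_mem measurableSet_Ioo] with t hkt ht
    -- Half of `k t` is added to the energy, and `k t ≤ E t - ℰ`, so the left side is at most that
    -- of `h2`; `hE0` replaces the initial energy by `E 0`.
    have h2 := F.energy_add_dissipation_le hΩ_open hΩ_bdd hF hC hE hf ht
    have h3 := energy_congr hv0 hd0
    have h4 := hE t (Ioo_subset_Icc_self ht)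
    simp only [frob_stressD_symPart]
    rw [h1, h3, ← hE0, intervalIntegral.integral_of_le ht.1.le]
    simp only [FlowFields.dissipation] at h2
    linarith
  · filter_upwards [hkf] with t hkt
    -- Both expressions for the mass equal `k t`, and `½ k ≤ k ≤ E - ℰ` leaves a factor of two to
    -- spare.
    rw [h1, trace_defectMeasure hk0]
    refine ⟨rfl, ?_⟩
    linarith [hk0 t]
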